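/- Let $d\in\mathbb{N}$, $\alpha\in(0,2]$ and $p\in(0,1)$ with $\alpha p>1$. On a probability space let $\xi_1,\xi_2,\dots$ be i.i.d. $\mathbb{R}^d$-valued random variables with $\mathbb{E}\big[e^{\mathrm{i}\langle\theta,\xi_1\rangle}\big]=e^{-\|\theta\|^\alpha}$ for all $\theta\in\mathbb{R}^d$ (Euclidean norm); let $U_n$ ($n\ge 2$) be uniform on $\{1,\dots,n-1\}$ and let $\varepsilon_n$ ($n\ge2$) be Bernoulli variables with success probability $p$, all these variables being independent. The shark random swim is $S_n=\sum_{k=1}^n Y_k$, where $Y_1=\xi_1$ and, for $n\ge2$, $Y_n=Y_{U_n}$ if $\varepsilon_n=1$ and $Y_n=\xi_n$ if $\varepsilon_n=0$. Let $T_n$ be the random recursive tree on the nodes $1,\dots,n$ in which each node $2\le k\le n$ is attached to the node $U_k$, and perform Bernoulli bond percolation on it by deleting the edge between $k$ and $U_k$ if $\varepsilon_k=0$ and keeping it if $\varepsilon_k=1$. Let $c_{i,n}$ be the percolation cluster rooted at $i$, that is, the connected component of $i$ if $i$ is its smallest label, and $c_{i,n}=\emptyset$ if there is no cluster rooted at $i$.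 Then for each $i\ge1$ the limit $X_i=\lim_{n\to\infty}n^{-p}|c_{i,n}|$ exists in $[0,\infty)$ almost surely; the series $Z=\sum_{i=1}^\infty X_i\xi_i$, understood as the limit of its partial sums $\sum_{i=1}^m X_i\xi_i$ as $m\to\infty$, converges almost surely in $\mathbb{R}^d$ (so $|Z|<\infty$ almost surely); and for every $t\ge0$, $$\frac1{n^p}S_{\lfloor nt\rfloor}\longrightarrow t^pZ\quad\text{in probability as }n\to\infty .$$ -/

import Mathlib

open MeasureTheory ProbabilityTheory Filter Topology

/-! Nodes, steps and spins are indexed from `0`: index `k` stands for the label `k + 1`, so the root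
and the first step have index `0`.  A recursive tree is encoded by its attachment sequence `u`:
the node with index `k + 1` is attached to the node with index `u k ∈ {0, …, k}`.  The percolation
is encoded by `e`: the edge from the node with index `k + 1` to its parent is kept if `e k = true`
and deleted if `e k = false`. -/

/-- The recursive tree with `n` nodes built from the attachment sequence `u`. -/
def recursiveTree (u : ∀ k : ℕ, Fin (k + 1)) (n : ℕ) : SimpleGraph (Fin n) :=
  SimpleGraph.fromRel fun a b => ∃ k : ℕ, (a : ℕ) = k + 1 ∧ (b : ℕ) = (u k : ℕ)

/-- The forest that is left of the recursive tree with `n` nodes after the edges between a node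
and its parent which are marked `false` have been deleted. -/
def percolatedTree (u : ∀ k : ℕ, Fin (k + 1)) (e : ℕ → Bool) (n : ℕ) : SimpleGraph (Fin n) :=
  (recursiveTree u n).deleteEdges
    {s | ∃ (a b : Fin n) (k : ℕ), s = s(a, b) ∧ (a : ℕ) = k + 1 ∧ (b : ℕ) = (u k : ℕ) ∧ e k = false}

/-- The cluster rooted at the node `i` in the percolated tree with `n` nodes: the connected
component of `i` if `i` is the smallest node (the root) of its component, and the empty set if
there is no cluster rooted at `i`. -/
def cluster (u : ∀ k : ℕ, Fin (k + 1)) (e : ℕ → Bool) (i n : ℕ) : Set (Fin n) :=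
  {v | ∃ r : Fin n, (r : ℕ) = i ∧ (∀ w, (percolatedTree u e n).Reachable r w → r ≤ w) ∧
    (percolatedTree u e n).Reachable r v}

/-- The steps of the shark: the first step is `x 0`; the step with index `k + 1` repeats the past
step with index `u k ∈ {0, …, k}` if `e k = true`, and is the fresh step `x (k + 1)` otherwise. -/
def sharkStep {E : Type*} (x : ℕ → E) (u : ∀ k : ℕ, Fin (k + 1)) (e : ℕ → Bool) : ℕ → E
  | 0 => x 0
  | k + 1 => if e k = true then sharkStep x u e (u k : ℕ) else x (k + 1)
termination_by k => k
decreasing_by exact (u k).isLt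

/-- The position of the shark after `n` steps. -/
def sharkSwim {E : Type*} [AddCommMonoid E] (x : ℕ → E) (u : ∀ k : ℕ, Fin (k + 1)) (e : ℕ → Bool)
    (n : ℕ) : E :=
  ∑ k ∈ Finset.range n, sharkStep x u e k

/-- The random ingredients of the shark random swim in dimension `d` with stability parameter `α`
and memory parameter `p`: the fresh steps `ξ` are i.i.d. standard isotropic strictly `α`-stable,
the remembered past steps `U k` are uniform on `{0, …, k}`, the events that a past step is
repeated have probability `p`, and all these variables are independent. -/
structure IsSharkNoise {Ω : Type*} [MeasurableSpace Ω] (μ : Measure Ω) {d : ℕ} (α p : ℝ)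
    (ξ : ℕ → Ω → EuclideanSpace ℝ (Fin d)) (U : ∀ k : ℕ, Ω → Fin (k + 1)) (ε : ℕ → Ω → Bool) :
    Prop where
  measurable_step : ∀ k, Measurable (ξ k)
  measurable_choice : ∀ k, Measurable (U k)
  measurable_keep : ∀ k, Measurable (ε k)
  charFun_step : ∀ k (θ : EuclideanSpace ℝ (Fin d)),
    charFun (μ.map (ξ k)) θ = ((Real.exp (-‖θ‖ ^ α) : ℝ) : ℂ)
  uniform_choice : ∀ k (j : Fin (k + 1)), μ.real {ω | U k ω = j} = 1 / ((k : ℝ) + 1)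
  prob_keep : ∀ k, μ.real {ω | ε k ω = true} = p
  indep_step : iIndepFun ξ μ
  indep_choice : iIndepFun U μ
  indep_keep : iIndepFun ε μ
  indep_choice_keep : IndepFun (fun ω k => U k ω) (fun ω k => ε k ω) μ
  indep_step_tree :
    IndepFun (fun ω k => ξ k ω) (fun ω => ((fun k => U k ω), (fun k => ε k ω))) μ

/-! Every step of the shark copies the fresh step at the root of its percolation cluster, so the
position is a sum of the `ξ i` weighted by cluster sizes (`sharkSwim_eq_sum_clusterSize`). The
weights depend only on the tree, which is independent of the steps. With the tree frozen, a finite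
sum `∑ w i • ξ i` is again stable and is controlled by `∑ |w i| ^ α` alone (`charFun_sum_smul`).

Write `N` for the size of cluster `i` in the tree with `k + 1` nodes. The next node joins that
cluster with conditional probability `p * N / (k + 1)` (`integral_mul_attach`). Hence the size
divided by (number of nodes)`^ p` is a nonnegative submartingale, and once node `i` is present the
mean of `N * (N + 1)` is multiplied by exactly `1 + 2p/(k + 1)`, which gives a second moment of
order `(n / (i + 1)) ^ (2p)` (`integral_clusterSize_sq_le`). This bounds the submartingale in L¹, so
it converges almost surely to `X i`. Interpolation below the exponent 2 bounds the `α`-th moments of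
the rescaled sizes by a multiple of `(i + 1) ^ (-(α p))`, uniformly in `n`, and Fatou passes this to
`X i`. The bound is summable because `α p > 1`.

So `∑ |X i| ^ α` is almost surely finite. For frozen weights with this property the coordinates of
the partial sums are L¹-bounded martingales (here `α > 1` is used), hence the series `Z` converges.
The same moment bounds make the contribution of the clusters beyond the first `m` small in
probability uniformly in `n` (`measure_norm_tail_le`), while the first `m` terms converge almost
surely for fixed `m`; sending `m` to infinity concludes. -/

/-- The smallest index in the percolation cluster of a node of the infinite recursive tree. -/
def clusterRoot (u : ∀ k : ℕ, Fin (k + 1)) (e : ℕ → Bool) : ℕ → ℕ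
  | 0 => 0
  | k + 1 => if e k = true then clusterRoot u e (u k : ℕ) else k + 1
termination_by k => k
decreasing_by exact (u k).isLt

/-- The number of nodes of the tree with `n` nodes whose cluster is rooted at `i`. -/
def clusterSize (u : ∀ k : ℕ, Fin (k + 1)) (e : ℕ → Bool) (i n : ℕ) : ℕ :=
  ((Finset.range n).filter fun k => clusterRoot u e k = i).card

/-! ### Clusters described by their roots -/

section Combinatorics

variable (u : ∀ k : ℕ, Fin (k + 1)) (e : ℕ → Bool)

lemma clusterRoot_zero : clusterRoot u e 0 = 0 := by rw [clusterRoot]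

lemma clusterRoot_succ (k : ℕ) :
    clusterRoot u e (k + 1) = if e k = true then clusterRoot u e (u k : ℕ) else k + 1 := by
  rw [clusterRoot]

lemma clusterRoot_le (k : ℕ) : clusterRoot u e k ≤ k := by
  induction k using Nat.strong_induction_on with
  | _ k ih =>
    cases k with
    | zero => simp [clusterRoot_zero]
    | succ k =>
      rw [clusterRoot_succ]
      split_ifs
      · have := ih (u k) (u k).isLt
        have := (u k).isLt
        omega
      · exact le_rfl

lemma sharkStep_eq_clusterRoot {E : Type*} (x : ℕ → E) (k : ℕ) :
    sharkStep x u e k = x (clusterRoot u e k) := by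
  induction k using Nat.strong_induction_on with
  | _ k ih =>
    cases k with
    | zero => rw [sharkStep, clusterRoot_zero]
    | succ k =>
      rw [sharkStep, clusterRoot_succ]
      split_ifs
      · exact ih (u k) (u k).isLt
      · rfl

lemma sharkSwim_eq_sum_clusterSize {E : Type*} [AddCommGroup E] [Module ℝ E] (x : ℕ → E) (n : ℕ) :
    sharkSwim x u e n = ∑ i ∈ Finset.range n, (clusterSize u e i n : ℝ) • x i := by
  have h : ∀ k ∈ Finset.range n, clusterRoot u e k ∈ Finset.range n := fun k hk =>
    Finset.mem_range.2 ((clusterRoot_le u e k).trans_lt (Finset.mem_range.1 hk))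
  rw [sharkSwim, ← Finset.sum_fiberwise_of_maps_to h]
  refine Finset.sum_congr rfl fun i _ => ?_
  rw [clusterSize, Nat.cast_smul_eq_nsmul, ← Finset.sum_const]
  refine Finset.sum_congr rfl fun k hk => ?_
  rw [sharkStep_eq_clusterRoot, (Finset.mem_filter.1 hk).2]

variable {u e}

lemma clusterRoot_eq_of_adj {n : ℕ} {a b : Fin n} (h : (percolatedTree u e n).Adj a b) :
    clusterRoot u e a = clusterRoot u e b := by
  rw [percolatedTree, SimpleGraph.deleteEdges_adj, recursiveTree, SimpleGraph.fromRel_adj] at h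
  obtain ⟨⟨-, h⟩, hd⟩ := h
  have key : ∀ (a b : Fin n) (k : ℕ), (a : ℕ) = k + 1 → (b : ℕ) = (u k : ℕ) → e k = true →
      clusterRoot u e a = clusterRoot u e b := by
    intro a b k ha hb hk
    rw [ha, hb, clusterRoot_succ, if_pos hk]
  rcases h with ⟨k, ha, hb⟩ | ⟨k, hb, ha⟩
  · refine key a b k ha hb ?_
    by_contra hk
    exact hd ⟨a, b, k, rfl, ha, hb, by simpa using hk⟩
  · refine (key b a k hb ha ?_).symm
    by_contra hk
    exact hd ⟨b, a, k, Sym2.eq_swap, hb, ha, by simpa using hk⟩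

lemma clusterRoot_eq_of_reachable {n : ℕ} {a b : Fin n}
    (h : (percolatedTree u e n).Reachable a b) : clusterRoot u e a = clusterRoot u e b := by
  obtain ⟨w⟩ := h
  induction w with
  | nil => rfl
  | cons h _ ih => exact (clusterRoot_eq_of_adj h).trans ih

lemma percolatedTree_adj_parent {n k : ℕ} (hk : k + 1 < n) (he : e k = true) :
    (percolatedTree u e n).Adj ⟨k + 1, hk⟩ ⟨u k, (u k).isLt.trans hk⟩ := by
  have hu := (u k).isLt
  rw [percolatedTree, SimpleGraph.deleteEdges_adj, recursiveTree, SimpleGraph.fromRel_adj]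
  refine ⟨⟨fun h => ?_, Or.inl ⟨k, rfl, rfl⟩⟩, ?_⟩
  · have := congrArg Fin.val h
    simp only at this
    omega
  · rintro ⟨a, b, l, hs, ha, hb, hl⟩
    rcases Sym2.eq_iff.1 hs with ⟨rfl, rfl⟩ | ⟨rfl, rfl⟩
    · simp only [Nat.add_right_cancel_iff] at ha
      subst ha
      simp [he] at hl
    -- In the swapped orientation parents would give `k + 1 = u l ≤ l < l + 1 = u k ≤ k`.
    · simp only at ha hb
      have := (u l).isLt
      omega

lemma reachable_clusterRoot {n : ℕ} (k : ℕ) (hk : k < n) :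
    (percolatedTree u e n).Reachable ⟨k, hk⟩
      ⟨clusterRoot u e k, (clusterRoot_le u e k).trans_lt hk⟩ := by
  induction k using Nat.strong_induction_on with
  | _ k ih =>
    cases k with
    | zero => simp only [clusterRoot_zero]; exact SimpleGraph.Reachable.refl _
    | succ k =>
      by_cases he : e k = true
      · have h := ih (u k) (u k).isLt ((u k).isLt.trans hk)
        simp only [clusterRoot_succ, he, if_true]
        exact (percolatedTree_adj_parent hk he).reachable.trans h
      · simp only [clusterRoot_succ, he]
        exact SimpleGraph.Reachable.refl _

variable (u e)

/-- `clusterRoot` is constant along kept edges, never exceeds the index, and is reached by following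
kept edges to parents; so it is the minimum of the component. If `i` is not a root, both sides are
empty. -/
lemma cluster_eq_setOf_clusterRoot (i n : ℕ) :
    cluster u e i n = {v : Fin n | clusterRoot u e v = i} := by
  ext v
  simp only [cluster, Set.mem_ofPred_eq]
  constructor
  · rintro ⟨r, rfl, hmin, hv⟩
    rw [← clusterRoot_eq_of_reachable hv]
    exact le_antisymm (clusterRoot_le u e r) (hmin _ (reachable_clusterRoot r r.isLt))
  · rintro rfl
    have hr := reachable_clusterRoot (u := u) (e := e) v v.isLt
    refine ⟨_, rfl, fun w hw => ?_, hr.symm⟩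
    have h := clusterRoot_eq_of_reachable (hr.trans hw)
    exact Fin.le_def.2 (h.trans_le (clusterRoot_le u e w))

lemma ncard_cluster (i n : ℕ) : (cluster u e i n).ncard = clusterSize u e i n := by
  rw [cluster_eq_setOf_clusterRoot, clusterSize, ← Set.ncard_image_of_injective _ Fin.val_injective,
    ← Set.ncard_coe_finset]
  congr 1
  ext k
  simp only [Set.mem_image, Set.mem_ofPred_eq, Finset.coe_filter, Finset.mem_range]
  exact ⟨fun ⟨v, hv, hk⟩ => hk ▸ ⟨v.isLt, hv⟩, fun ⟨hk, h⟩ => ⟨⟨k, hk⟩, h, rfl⟩⟩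

lemma clusterSize_succ (i n : ℕ) : clusterSize u e i (n + 1) =
    clusterSize u e i n + if clusterRoot u e n = i then 1 else 0 := by
  rw [clusterSize, Finset.range_add_one, Finset.filter_insert]
  split_ifs
  · rw [Finset.card_insert_of_notMem (by simp)]; rfl
  · rfl

lemma clusterSize_le (i n : ℕ) : clusterSize u e i n ≤ n :=
  (Finset.card_filter_le _ _).trans (Finset.card_range n).le

lemma clusterSize_eq_zero {i n : ℕ} (h : n ≤ i) : clusterSize u e i n = 0 := by
  rw [clusterSize, Finset.card_eq_zero, Finset.filter_eq_empty_iff]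
  intro k hk
  have := clusterRoot_le u e k
  have := Finset.mem_range.1 hk
  omega

lemma cast_clusterSize (i n : ℕ) : (clusterSize u e i n : ℝ) =
    ∑ k ∈ Finset.range n, if clusterRoot u e k = i then (1 : ℝ) else 0 := by
  rw [clusterSize, Finset.card_filter]
  push_cast
  rfl

end Combinatorics

/-! ### Measurability and independence of the marks -/

/-- Only the marks below `n` are required to be measurable, and the σ-algebra is arbitrary, so that
it can be instantiated with the tree filtration at time `n`. -/
lemma measurable_clusterRoot {Ω : Type*} [MeasurableSpace Ω] {U : ∀ k : ℕ, Ω → Fin (k + 1)}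
    {ε : ℕ → Ω → Bool} {n : ℕ} (hU : ∀ k < n, Measurable (U k)) (hε : ∀ k < n, Measurable (ε k))
    {k : ℕ} (hk : k ≤ n) : Measurable fun ω => clusterRoot (U · ω) (ε · ω) k := by
  induction k using Nat.strong_induction_on with
  | _ k ih =>
    cases k with
    | zero => simp only [clusterRoot_zero]; exact measurable_const
    | succ k =>
      simp only [clusterRoot_succ]
      refine Measurable.ite (hε k hk (measurableSet_singleton true)) ?_ measurable_const
      have h : Measurable fun q : Ω × Fin (k + 1) => clusterRoot (U · q.1) (ε · q.1) q.2 :=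
        measurable_from_prod_countable_left fun j => ih j j.isLt (by have := j.isLt; omega)
      exact h.comp (measurable_id.prodMk (hU k hk))

lemma measurable_clusterSize {Ω : Type*} [MeasurableSpace Ω] {U : ∀ k : ℕ, Ω → Fin (k + 1)}
    {ε : ℕ → Ω → Bool} {n : ℕ} (hU : ∀ k < n, Measurable (U k)) (hε : ∀ k < n, Measurable (ε k))
    (i : ℕ) : Measurable fun ω => (clusterSize (U · ω) (ε · ω) i (n + 1) : ℝ) := by
  simp only [cast_clusterSize]
  refine Finset.measurable_sum _ fun k hk => ?_
  exact Measurable.ite (measurable_clusterRoot hU hε (Nat.lt_succ_iff.1 (Finset.mem_range.1 hk))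
    (measurableSet_singleton i)) measurable_const measurable_const

lemma integrable_of_bounded {Ω : Type*} [MeasurableSpace Ω] {μ : Measure Ω} [IsFiniteMeasure μ]
    {f : Ω → ℝ} (hf : Measurable f) {C : ℝ} (hC : ∀ ω, |f ω| ≤ C) : Integrable f μ :=
  Integrable.of_bound hf.aestronglyMeasurable C (ae_of_all _ hC)

/-- Rectangles form a generating π-system for each pair, and on them the probability factors first
between the two families and then within each one. -/
lemma iIndepFun_prodMk {Ω ι : Type*} [MeasurableSpace Ω] {μ : Measure Ω}
    {β γ : ι → Type*} [∀ i, MeasurableSpace (β i)]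
    [∀ i, MeasurableSpace (γ i)] {f : ∀ i, Ω → β i} {g : ∀ i, Ω → γ i}
    (hfm : ∀ i, Measurable (f i)) (hgm : ∀ i, Measurable (g i))
    (hf : iIndepFun f μ) (hg : iIndepFun g μ)
    (hfg : IndepFun (fun ω i => f i ω) (fun ω i => g i ω) μ) :
    iIndepFun (fun i ω => (f i ω, g i ω)) μ := by
  let π : ι → Set (Set Ω) := fun i =>
    {s | ∃ A B, MeasurableSet A ∧ MeasurableSet B ∧ s = f i ⁻¹' A ∩ g i ⁻¹' B}
  have hπ : ∀ i, IsPiSystem (π i) := by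
    rintro i _ ⟨A, B, hA, hB, rfl⟩ _ ⟨A', B', hA', hB', rfl⟩ -
    exact ⟨A ∩ A', B ∩ B', hA.inter hA', hB.inter hB', by
      rw [Set.preimage_inter, Set.preimage_inter, Set.inter_inter_inter_comm]⟩
  rw [iIndepFun_iff_iIndep]
  refine iIndepSets.iIndep (fun i => ((hfm i).prodMk (hgm i)).comap_le) π hπ (fun i => ?_) ?_
  · rw [← generateFrom_prod, MeasurableSpace.comap_generateFrom]
    congr 1
    ext s
    constructor
    · rintro ⟨_, ⟨A, hA, B, hB, rfl⟩, rfl⟩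
      exact ⟨A, B, hA, hB, rfl⟩
    · rintro ⟨A, B, hA, hB, rfl⟩
      exact ⟨A ×ˢ B, ⟨A, hA, B, hB, rfl⟩, rfl⟩
  · rw [iIndepSets_iff]
    intro S s hs
    choose! A B hA hB hs using hs
    have h1 : ⋂ i ∈ S, s i = (fun ω i => f i ω) ⁻¹' (⋂ i ∈ S, {x | x i ∈ A i}) ∩
        (fun ω i => g i ω) ⁻¹' (⋂ i ∈ S, {x | x i ∈ B i}) := by
      ext ω
      simp only [Set.mem_iInter, Set.mem_inter_iff, Set.mem_preimage, Set.mem_ofPred_eq]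
      rw [← forall₂_and]
      refine forall₂_congr fun i hi => ?_
      rw [hs i hi]
      rfl
    have hA' : MeasurableSet (⋂ i ∈ S, {x : ∀ i, β i | x i ∈ A i}) :=
      S.measurableSet_biInter fun i hi => measurable_pi_apply i (hA i hi)
    have hB' : MeasurableSet (⋂ i ∈ S, {x : ∀ i, γ i | x i ∈ B i}) :=
      S.measurableSet_biInter fun i hi => measurable_pi_apply i (hB i hi)
    rw [h1, indepFun_iff_measure_inter_preimage_eq_mul.1 hfg _ _ hA' hB']
    have e1 : (fun ω i => f i ω) ⁻¹' (⋂ i ∈ S, {x | x i ∈ A i}) = ⋂ i ∈ S, f i ⁻¹' A i := by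
      ext; simp
    have e2 : (fun ω i => g i ω) ⁻¹' (⋂ i ∈ S, {x | x i ∈ B i}) = ⋂ i ∈ S, g i ⁻¹' B i := by
      ext; simp
    rw [e1, e2, iIndepFun_iff_measure_inter_preimage_eq_mul.1 hf S hA,
      iIndepFun_iff_measure_inter_preimage_eq_mul.1 hg S hB, ← Finset.prod_mul_distrib]
    refine Finset.prod_congr rfl fun i hi => ?_
    rw [hs i hi]
    have h2 := indepFun_iff_measure_inter_preimage_eq_mul.1 hfg {x | x i ∈ A i} {x | x i ∈ B i}
      (measurable_pi_apply i (hA i hi)) (measurable_pi_apply i (hB i hi))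
    exact h2.symm

/-! ### The tree filtration and the attachment probability -/

section Tree

variable {Ω : Type*} [MeasurableSpace Ω] {U : ∀ k : ℕ, Ω → Fin (k + 1)} {ε : ℕ → Ω → Bool}

/-- The filtration generated by the attachments and the percolation marks. -/
def treeFiltration (hU : ∀ k, Measurable (U k)) (hε : ∀ k, Measurable (ε k)) :
    Filtration ℕ (inferInstance : MeasurableSpace Ω) where
  seq n := ⨆ k ∈ {k : ℕ | k < n}, MeasurableSpace.comap (fun ω => (U k ω, ε k ω)) inferInstance
  mono' _ _ h := biSup_mono fun _ hk => lt_of_lt_of_le hk h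
  le' _ := iSup₂_le fun k _ => ((hU k).prodMk (hε k)).comap_le

variable (hU : ∀ k, Measurable (U k)) (hε : ∀ k, Measurable (ε k))

lemma measurable_prodMk_treeFiltration {k n : ℕ} (hk : k < n) :
    Measurable[treeFiltration hU hε n] fun ω => (U k ω, ε k ω) :=
  (comap_measurable _).mono (le_iSup₂ (f := fun (k : ℕ) (_ : k ∈ {k : ℕ | k < n}) =>
    MeasurableSpace.comap (fun ω => (U k ω, ε k ω)) inferInstance) k hk) le_rfl

lemma measurable_clusterRoot_treeFiltration {k n : ℕ} (hk : k ≤ n) :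
    Measurable[treeFiltration hU hε n] fun ω => clusterRoot (U · ω) (ε · ω) k :=
  @measurable_clusterRoot Ω (treeFiltration hU hε n) U ε n
    (fun _ hl => measurable_fst.comp (measurable_prodMk_treeFiltration hU hε hl))
    (fun _ hl => measurable_snd.comp (measurable_prodMk_treeFiltration hU hε hl)) k hk

lemma measurable_clusterSize_treeFiltration (i n : ℕ) :
    Measurable[treeFiltration hU hε n] fun ω => (clusterSize (U · ω) (ε · ω) i (n + 1) : ℝ) :=
  @measurable_clusterSize Ω (treeFiltration hU hε n) U ε n
    (fun _ hl => measurable_fst.comp (measurable_prodMk_treeFiltration hU hε hl))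
    (fun _ hl => measurable_snd.comp (measurable_prodMk_treeFiltration hU hε hl)) i

end Tree

namespace IsSharkNoise

variable {Ω : Type*} [MeasurableSpace Ω] {μ : Measure Ω} {d : ℕ} {α p : ℝ}
  {ξ : ℕ → Ω → EuclideanSpace ℝ (Fin d)} {U : ∀ k : ℕ, Ω → Fin (k + 1)} {ε : ℕ → Ω → Bool}

lemma iIndepFun_tree (h : IsSharkNoise μ α p ξ U ε) :
    iIndepFun (fun k ω => (U k ω, ε k ω)) μ :=
  iIndepFun_prodMk h.measurable_choice h.measurable_keep h.indep_choice h.indep_keep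
    h.indep_choice_keep

/-- The filtration generated by the random tree and the percolation. -/
noncomputable abbrev filtration (h : IsSharkNoise μ α p ξ U ε) :=
  treeFiltration h.measurable_choice h.measurable_keep

/-- Time `n` knows the marks below `n`, that is, the tree with `n + 1` nodes; mark `n` decides how
the node `n + 1` is attached. -/
lemma indep_filtration (h : IsSharkNoise μ α p ξ U ε) (n : ℕ) :
    Indep (h.filtration n) (MeasurableSpace.comap (fun ω => (U n ω, ε n ω)) inferInstance) μ := by
  have := indep_iSup_of_disjoint (S := {k : ℕ | k < n}) (T := {n})
    (fun k => ((h.measurable_choice k).prodMk (h.measurable_keep k)).comap_le)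
    ((iIndepFun_iff_iIndep _ _ _).1 h.iIndepFun_tree) (by simp)
  rwa [iSup_singleton] at this

lemma measurable_clusterSize (h : IsSharkNoise μ α p ξ U ε) (i n : ℕ) :
    Measurable fun ω => (clusterSize (U · ω) (ε · ω) i n : ℝ) := by
  cases n with
  | zero => simp [clusterSize]
  | succ n =>
    exact _root_.measurable_clusterSize (fun k _ => h.measurable_choice k)
      (fun k _ => h.measurable_keep k) i

lemma integral_choice_keep (h : IsSharkNoise μ α p ξ U ε) (k : ℕ) (j : Fin (k + 1)) :
    ∫ ω, (if U k ω = j ∧ ε k ω = true then (1 : ℝ) else 0) ∂μ = p / (k + 1) := by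
  have hm : MeasurableSet {ω | U k ω = j ∧ ε k ω = true} :=
    ((h.measurable_choice k) (measurableSet_singleton j)).inter
      ((h.measurable_keep k) (measurableSet_singleton true))
  have e : (fun ω => if U k ω = j ∧ ε k ω = true then (1 : ℝ) else 0) =
      {ω | U k ω = j ∧ ε k ω = true}.indicator 1 := by
    ext ω; simp [Set.indicator_apply]
  rw [e, integral_indicator_one hm]
  have hi := indepFun_iff_measure_inter_preimage_eq_mul.1 h.indep_choice_keep
    ((fun x => x k) ⁻¹' {j}) ((fun x => x k) ⁻¹' {true})
    (measurable_pi_apply k (measurableSet_singleton j))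
    (measurable_pi_apply k (measurableSet_singleton true))
  have h1 := h.uniform_choice k j
  have h2 := h.prob_keep k
  rw [Measure.real] at h1 h2 ⊢
  refine (congrArg ENNReal.toReal hi).trans ?_
  rw [ENNReal.toReal_mul]
  refine (congrArg₂ (· * ·) h1 h2).trans ?_
  ring

variable [IsProbabilityMeasure μ]

lemma integrable_clusterSize (h : IsSharkNoise μ α p ξ U ε) (i n : ℕ) :
    Integrable (fun ω => (clusterSize (U · ω) (ε · ω) i n : ℝ)) μ :=
  integrable_of_bounded (h.measurable_clusterSize i n) (C := n) fun ω => by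
    rw [abs_of_nonneg (Nat.cast_nonneg _)]
    exact_mod_cast clusterSize_le _ _ _ _

/-- The conditional attachment probability `p * N / (k + 1)`, tested against bounded functions `g`
of the past. Splitting over the parent `j` separates a past factor from an independent factor of
mean `p / (k + 1)`. -/
lemma integral_mul_attach (h : IsSharkNoise μ α p ξ U ε) (i k : ℕ) {g : Ω → ℝ}
    (hg : Measurable[h.filtration k] g) {C : ℝ} (hC : ∀ ω, |g ω| ≤ C) :
    ∫ ω, g ω * (if ε k ω = true ∧ clusterRoot (U · ω) (ε · ω) (U k ω) = i then (1 : ℝ) else 0) ∂μ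
      = p / (k + 1) * ∫ ω, g ω * (clusterSize (U · ω) (ε · ω) i (k + 1) : ℝ) ∂μ := by
  have hle := h.filtration.le k
  have hφ : ∀ j : Fin (k + 1), Measurable[h.filtration k]
      fun ω => g ω * (if clusterRoot (U · ω) (ε · ω) j = i then (1 : ℝ) else 0) := fun j => by
    refine Measurable.mul hg (Measurable.ite ?_ measurable_const measurable_const)
    exact measurable_clusterRoot_treeFiltration h.measurable_choice h.measurable_keep
      (Nat.lt_succ_iff.1 j.isLt) (measurableSet_singleton i)
  have hφb : ∀ (j : Fin (k + 1)) ω,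
      |g ω * (if clusterRoot (U · ω) (ε · ω) j = i then (1 : ℝ) else 0)| ≤ C := fun j ω => by
    split_ifs
    · simpa using hC ω
    · simpa using (abs_nonneg _).trans (hC ω)
  have hψW : ∀ j : Fin (k + 1), Measurable fun q : Fin (k + 1) × Bool =>
      if q.1 = j ∧ q.2 = true then (1 : ℝ) else 0 := fun j => Measurable.of_discrete
  have hψ : ∀ j : Fin (k + 1), Measurable[MeasurableSpace.comap (fun ω => (U k ω, ε k ω))
      inferInstance] fun ω => if U k ω = j ∧ ε k ω = true then (1 : ℝ) else 0 := fun j =>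
    (hψW j).comp (comap_measurable _)
  have hWm : Measurable fun ω => (U k ω, ε k ω) :=
    (h.measurable_choice k).prodMk (h.measurable_keep k)
  have hψb : ∀ (j : Fin (k + 1)) ω, |if U k ω = j ∧ ε k ω = true then (1 : ℝ) else 0| ≤ 1 :=
    fun j ω => by split_ifs <;> simp
  have e1 : ∀ ω, g ω * (if ε k ω = true ∧ clusterRoot (U · ω) (ε · ω) (U k ω) = i
      then (1 : ℝ) else 0) = ∑ j : Fin (k + 1),
      (g ω * (if clusterRoot (U · ω) (ε · ω) j = i then (1 : ℝ) else 0)) *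
        (if U k ω = j ∧ ε k ω = true then (1 : ℝ) else 0) := fun ω => by
    rw [Finset.sum_eq_single (U k ω)]
    · by_cases hε : ε k ω = true <;> simp [hε]
    · intro j _ hj
      simp [hj.symm]
    · simp
  have e2 : ∀ ω, g ω * (clusterSize (U · ω) (ε · ω) i (k + 1) : ℝ) = ∑ j : Fin (k + 1),
      (g ω * (if clusterRoot (U · ω) (ε · ω) j = i then (1 : ℝ) else 0)) := fun ω => by
    rw [cast_clusterSize, Finset.sum_range, Finset.mul_sum]
  simp only [e1, e2]
  rw [integral_finsetSum, integral_finsetSum, Finset.mul_sum]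
  · refine Finset.sum_congr rfl fun j _ => ?_
    have hind : IndepFun
        (fun ω => g ω * (if clusterRoot (U · ω) (ε · ω) j = i then (1 : ℝ) else 0))
        (fun ω => if U k ω = j ∧ ε k ω = true then (1 : ℝ) else 0) μ := by
      rw [IndepFun_iff_Indep]
      exact indep_of_indep_of_le_left (indep_of_indep_of_le_right (h.indep_filtration k)
        (hψ j).comap_le) (hφ j).comap_le
    have := hind.integral_fun_mul_eq_mul_integral
      ((hφ j).mono hle le_rfl).aestronglyMeasurable
      ((hψW j).comp hWm).aestronglyMeasurable
    rw [this, h.integral_choice_keep, mul_comm]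
  · exact fun j _ => integrable_of_bounded ((hφ j).mono hle le_rfl) (hφb j)
  · refine fun j _ => integrable_of_bounded (C := C)
      (((hφ j).mono hle le_rfl).mul ((hψW j).comp hWm)) fun ω => ?_
    rw [abs_mul]
    exact (mul_le_of_le_one_right (abs_nonneg _) (hψb j ω)).trans (hφb j ω)

end IsSharkNoise

/-! ### Moments and convergence of the rescaled cluster sizes -/

lemma clusterSize_add_two (u : ∀ k : ℕ, Fin (k + 1)) (e : ℕ → Bool) {i k : ℕ} (hk : i ≤ k) :
    (clusterSize u e i (k + 2) : ℝ) = clusterSize u e i (k + 1) +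
      if e k = true ∧ clusterRoot u e (u k) = i then (1 : ℝ) else 0 := by
  rw [clusterSize_succ u e i (k + 1), clusterRoot_succ]
  by_cases he : e k = true
  · simp [he]
  · have : k + 1 ≠ i := by omega
    simp [he, this]

/-- The inequality survives for every `i`, since founding cluster `i` only adds a node; the
submartingale can thus start at time 0. -/
lemma le_clusterSize_add_two (u : ∀ k : ℕ, Fin (k + 1)) (e : ℕ → Bool) (i k : ℕ) :
    (clusterSize u e i (k + 1) : ℝ) +
      (if e k = true ∧ clusterRoot u e (u k) = i then (1 : ℝ) else 0) ≤
      clusterSize u e i (k + 2) := by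
  rw [clusterSize_succ u e i (k + 1), clusterRoot_succ]
  by_cases he : e k = true
  · simp [he]
  · have : (0 : ℝ) ≤ if k + 1 = i then 1 else 0 := by split_ifs <;> simp
    simpa [he] using this

namespace IsSharkNoise

variable {Ω : Type*} [MeasurableSpace Ω] {μ : Measure Ω} {d : ℕ} {α p : ℝ}
  {ξ : ℕ → Ω → EuclideanSpace ℝ (Fin d)} {U : ∀ k : ℕ, Ω → Fin (k + 1)} {ε : ℕ → Ω → Bool}

lemma prob_keep_nonneg (h : IsSharkNoise μ α p ξ U ε) : 0 ≤ p :=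
  h.prob_keep 0 ▸ measureReal_nonneg

lemma measurable_attach (h : IsSharkNoise μ α p ξ U ε) (i k : ℕ) : Measurable fun ω =>
    if ε k ω = true ∧ clusterRoot (U · ω) (ε · ω) (U k ω) = i then (1 : ℝ) else 0 := by
  have h1 : Measurable fun q : Ω × Fin (k + 1) => clusterRoot (U · q.1) (ε · q.1) q.2 :=
    measurable_from_prod_countable_left fun j =>
      measurable_clusterRoot (n := j) (fun k _ => h.measurable_choice k)
        (fun k _ => h.measurable_keep k) le_rfl
  have h2 := h1.comp (measurable_id.prodMk (h.measurable_choice k))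
  exact Measurable.ite ((h.measurable_keep k (measurableSet_singleton true)).inter
    (h2 (measurableSet_singleton i))) measurable_const measurable_const

variable [IsProbabilityMeasure μ]

/-- `N * (N + 1)` is chosen because one attachment raises it by `2 * (N + 1)`; multiplied by `p * N
/ (k + 1)` this is proportional to `N * (N + 1)` itself, with no lower-order term as for `N ^ 2`. -/
lemma integral_clusterSize_mul_add_one_succ (h : IsSharkNoise μ α p ξ U ε) {i k : ℕ} (hk : i ≤ k) :
    ∫ ω, (clusterSize (U · ω) (ε · ω) i (k + 2) : ℝ) *
        (clusterSize (U · ω) (ε · ω) i (k + 2) + 1) ∂μ =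
      (1 + 2 * p / (k + 1)) * ∫ ω, (clusterSize (U · ω) (ε · ω) i (k + 1) : ℝ) *
        (clusterSize (U · ω) (ε · ω) i (k + 1) + 1) ∂μ := by
  set N : Ω → ℝ := fun ω => (clusterSize (U · ω) (ε · ω) i (k + 1) : ℝ) with hN
  set I : Ω → ℝ := fun ω =>
    if ε k ω = true ∧ clusterRoot (U · ω) (ε · ω) (U k ω) = i then (1 : ℝ) else 0 with hI
  have hN0 : ∀ ω, 0 ≤ N ω := fun ω => Nat.cast_nonneg _
  have hNb : ∀ ω, N ω ≤ k + 1 := fun ω => by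
    change (clusterSize (U · ω) (ε · ω) i (k + 1) : ℝ) ≤ k + 1
    exact_mod_cast clusterSize_le (U · ω) (ε · ω) i (k + 1)
  have hNm : Measurable N := h.measurable_clusterSize i (k + 1)
  have hNF : Measurable[h.filtration k] fun ω => 2 * (N ω + 1) :=
    ((measurable_clusterSize_treeFiltration h.measurable_choice h.measurable_keep i k).add_const
      1).const_mul 2
  have hb : ∀ ω, |2 * (N ω + 1)| ≤ 2 * (k + 2) := fun ω => by
    rw [abs_of_nonneg (by linarith [hN0 ω])]
    linarith [hNb ω]
  have hI0 : ∀ ω, 0 ≤ I ω ∧ I ω ≤ 1 := fun ω => by simp only [hI]; split_ifs <;> simp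
  have e : ∀ ω, (clusterSize (U · ω) (ε · ω) i (k + 2) : ℝ) *
      (clusterSize (U · ω) (ε · ω) i (k + 2) + 1) = N ω * (N ω + 1) + 2 * (N ω + 1) * I ω := by
    intro ω
    rw [clusterSize_add_two _ _ hk]
    simp only [hN, hI]
    split_ifs <;> ring
  have i1 : Integrable (fun ω => N ω * (N ω + 1)) μ :=
    integrable_of_bounded (hNm.mul (hNm.add_const 1)) (C := (k + 1) * (k + 2)) fun ω => by
      rw [abs_of_nonneg (mul_nonneg (hN0 ω) (by linarith [hN0 ω]))]
      exact mul_le_mul (hNb ω) (by linarith [hNb ω]) (by linarith [hN0 ω]) (by positivity)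
  have i2 : Integrable (fun ω => 2 * (N ω + 1) * I ω) μ :=
    integrable_of_bounded (((hNm.add_const 1).const_mul 2).mul (h.measurable_attach i k))
      (C := 2 * (k + 2)) fun ω => by
        rw [abs_mul, abs_of_nonneg (hI0 ω).1]
        exact (mul_le_of_le_one_right (abs_nonneg _) (hI0 ω).2).trans (hb ω)
  simp only [e]
  rw [integral_add i1 i2, h.integral_mul_attach i k hNF hb]
  have e3 : ∀ ω, 2 * (N ω + 1) * (clusterSize (U · ω) (ε · ω) i (k + 1) : ℝ) =
      2 * (N ω * (N ω + 1)) := fun ω => by simp only [hN]; ring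
  simp only [e3]
  rw [integral_const_mul]
  ring

lemma integral_clusterSize_mul_add_one_le (h : IsSharkNoise μ α p ξ U ε) (hp : 1 ≤ 2 * p)
    {i k : ℕ} (hk : i ≤ k) :
    ∫ ω, (clusterSize (U · ω) (ε · ω) i (k + 1) : ℝ) *
        (clusterSize (U · ω) (ε · ω) i (k + 1) + 1) ∂μ ≤
      2 * (((k : ℝ) + 1) / ((i : ℝ) + 1)) ^ (2 * p) := by
  induction k, hk using Nat.le_induction with
  | base =>
    rw [div_self (by positivity), Real.one_rpow, mul_one]
    have hb : ∀ ω, (clusterSize (U · ω) (ε · ω) i (i + 1) : ℝ) ≤ 1 := fun ω => by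
      rw [clusterSize_succ, clusterSize_eq_zero _ _ le_rfl]
      split_ifs <;> simp
    calc _ ≤ ∫ _, (2 : ℝ) ∂μ := by
          refine integral_mono_of_nonneg (ae_of_all _ fun ω => by positivity)
            (integrable_const _) (ae_of_all _ fun ω => ?_)
          have := hb ω
          have h0 : (0 : ℝ) ≤ clusterSize (U · ω) (ε · ω) i (i + 1) := Nat.cast_nonneg _
          simp only
          nlinarith
      _ = 2 := by simp
  | succ k hk ih =>
    rw [h.integral_clusterSize_mul_add_one_succ hk]
    have hk0 : (0 : ℝ) < k + 1 := by positivity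
    have hi0 : (0 : ℝ) < i + 1 := by positivity
    -- Bernoulli's inequality for the exponent `2 * p ≥ 1`; the right-hand sides telescope to a
    -- power of `(k + 1) / (i + 1)`.
    have h1 : 1 + 2 * p / (k + 1) ≤ (1 + 1 / ((k : ℝ) + 1)) ^ (2 * p) := by
      refine le_trans (le_of_eq ?_) (one_add_mul_self_le_rpow_one_add (s := 1 / ((k : ℝ) + 1))
        (by have : (0 : ℝ) ≤ 1 / (k + 1) := by positivity
            linarith) hp)
      ring
    have h2 : (((k + 1 : ℕ) : ℝ) + 1) / (i + 1) =
        (1 + 1 / ((k : ℝ) + 1)) * (((k : ℝ) + 1) / (i + 1)) := by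
      push_cast
      field_simp
    rw [h2, Real.mul_rpow (by positivity) (by positivity)]
    have hp0 := h.prob_keep_nonneg
    calc _ ≤ (1 + 2 * p / (k + 1)) * (2 * (((k : ℝ) + 1) / (i + 1)) ^ (2 * p)) :=
          mul_le_mul_of_nonneg_left ih (by positivity)
      _ ≤ (1 + 1 / ((k : ℝ) + 1)) ^ (2 * p) * (2 * (((k : ℝ) + 1) / (i + 1)) ^ (2 * p)) :=
          mul_le_mul_of_nonneg_right h1 (by positivity)
      _ = _ := by ring

lemma integrable_clusterSize_sq (h : IsSharkNoise μ α p ξ U ε) (i n : ℕ) :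
    Integrable (fun ω => (clusterSize (U · ω) (ε · ω) i n : ℝ) ^ 2) μ :=
  integrable_of_bounded ((h.measurable_clusterSize i n).pow_const 2) (C := n ^ 2) fun ω => by
    rw [abs_of_nonneg (by positivity)]
    exact_mod_cast Nat.pow_le_pow_left (clusterSize_le _ _ _ _) 2

lemma integral_clusterSize_sq_le (h : IsSharkNoise μ α p ξ U ε) (hp : 1 ≤ 2 * p) (i n : ℕ) :
    ∫ ω, (clusterSize (U · ω) (ε · ω) i n : ℝ) ^ 2 ∂μ ≤
      2 * ((n : ℝ) / ((i : ℝ) + 1)) ^ (2 * p) := by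
  rcases le_or_gt n i with hn | hn
  · simp only [clusterSize_eq_zero _ _ hn]
    simp only [Nat.cast_zero, ne_eq, OfNat.ofNat_ne_zero, not_false_eq_true, zero_pow,
      integral_zero]
    positivity
  · obtain ⟨k, rfl⟩ : ∃ k, n = k + 1 := ⟨n - 1, by omega⟩
    have := h.integral_clusterSize_mul_add_one_le hp (i := i) (k := k) (by omega)
    push_cast
    refine le_trans (integral_mono_of_nonneg (ae_of_all _ fun ω => by positivity) ?_
      (ae_of_all _ fun ω => ?_)) this
    · have e : (fun ω => (clusterSize (U · ω) (ε · ω) i (k + 1) : ℝ) *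
          (clusterSize (U · ω) (ε · ω) i (k + 1) + 1)) = fun ω =>
          (clusterSize (U · ω) (ε · ω) i (k + 1) : ℝ) ^ 2 +
            clusterSize (U · ω) (ε · ω) i (k + 1) := by ext; ring
      rw [e]
      exact (h.integrable_clusterSize_sq i (k + 1)).add (h.integrable_clusterSize i (k + 1))
    · have h0 : (0 : ℝ) ≤ clusterSize (U · ω) (ε · ω) i (k + 1) := Nat.cast_nonneg _
      simp only
      nlinarith

/-- The mean growth factor is at least `1 + p/(k + 1)`, which dominates the growth `(1 + 1/(k + 1))
^ p` of the normalisation by Bernoulli's inequality for exponents in `[0, 1]`. -/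
lemma submartingale_clusterSize (h : IsSharkNoise μ α p ξ U ε) (hp1 : p ≤ 1) (i : ℕ) :
    Submartingale (fun (k : ℕ) ω => ((k + 1 : ℕ) : ℝ) ^ (-p) *
      (clusterSize (U · ω) (ε · ω) i (k + 1) : ℝ)) h.filtration μ := by
  refine submartingale_of_setIntegral_le_succ (fun k => ?_) (fun k => ?_) fun k s hs => ?_
  · exact ((measurable_clusterSize_treeFiltration h.measurable_choice h.measurable_keep i
      k).const_mul _).stronglyMeasurable
  · exact (h.integrable_clusterSize i (k + 1)).const_mul _
  · have hs' : MeasurableSet s := h.filtration.le k s hs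
    have hg : Measurable[h.filtration k] (s.indicator (1 : Ω → ℝ)) :=
      (@measurable_const _ _ _ (h.filtration k) (1 : ℝ)).indicator hs
    have key := h.integral_mul_attach i k hg (C := 1) fun ω => by
      by_cases hω : ω ∈ s <;> simp [hω]
    have ei : ∀ f : Ω → ℝ, ∫ ω, s.indicator (1 : Ω → ℝ) ω * f ω ∂μ = ∫ ω in s, f ω ∂μ := by
      intro f
      rw [← integral_indicator hs']
      refine integral_congr_ae (ae_of_all _ fun ω => ?_)
      by_cases hω : ω ∈ s <;> simp [hω]
    rw [ei, ei] at key
    have hN := (h.integrable_clusterSize i (k + 1)).integrableOn (s := s)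
    have hI : IntegrableOn (fun ω => if ε k ω = true ∧ clusterRoot (U · ω) (ε · ω) (U k ω) = i
        then (1 : ℝ) else 0) s μ :=
      (integrable_of_bounded (h.measurable_attach i k) (C := 1) fun ω => by
        split_ifs <;> simp).integrableOn
    have h1 : (1 + p / (k + 1)) * ∫ ω in s, (clusterSize (U · ω) (ε · ω) i (k + 1) : ℝ) ∂μ ≤
        ∫ ω in s, (clusterSize (U · ω) (ε · ω) i (k + 2) : ℝ) ∂μ := by
      calc _ = ∫ ω in s, ((clusterSize (U · ω) (ε · ω) i (k + 1) : ℝ) +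
            if ε k ω = true ∧ clusterRoot (U · ω) (ε · ω) (U k ω) = i then (1 : ℝ) else 0) ∂μ := by
            rw [integral_add hN hI, key]; ring
        _ ≤ _ := integral_mono (hN.add hI) (h.integrable_clusterSize i (k + 2)).integrableOn
            fun ω => le_clusterSize_add_two _ _ i k
    rw [integral_const_mul, integral_const_mul]
    have h0 : 0 ≤ ∫ ω in s, (clusterSize (U · ω) (ε · ω) i (k + 1) : ℝ) ∂μ :=
      integral_nonneg fun ω => Nat.cast_nonneg _
    have hp0 := h.prob_keep_nonneg
    have hk0 : (0 : ℝ) < k + 1 := by positivity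
    have h2 : (1 + 1 / ((k : ℝ) + 1)) ^ p ≤ 1 + p / (k + 1) := by
      refine (rpow_one_add_le_one_add_mul_self (s := 1 / ((k : ℝ) + 1))
        (by have : (0 : ℝ) ≤ 1 / (k + 1) := by positivity
            linarith) hp0 hp1).trans (le_of_eq ?_)
      ring
    have h3 : ((k + 1 : ℕ) : ℝ) ^ (-p) =
        ((k + 1 + 1 : ℕ) : ℝ) ^ (-p) * (1 + 1 / ((k : ℝ) + 1)) ^ p := by
      have : ((k + 1 + 1 : ℕ) : ℝ) = (k + 1) * (1 + 1 / ((k : ℝ) + 1)) := by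
        push_cast; field_simp
      rw [this, Real.mul_rpow (by positivity) (by positivity), mul_assoc,
        ← Real.rpow_add (by positivity)]
      simp
    rw [h3, mul_assoc]
    refine mul_le_mul_of_nonneg_left ?_ (by positivity)
    exact (mul_le_mul_of_nonneg_right h2 h0).trans h1

/-- The scale `c` is kept apart from the tree size `n` because the swim at time `⌊n * t⌋₊` is
rescaled by `n`. -/
lemma integral_scaled_clusterSize_sq_le (h : IsSharkNoise μ α p ξ U ε) (hp : 1 ≤ 2 * p)
    (i n : ℕ) {c : ℝ} (hc : 0 ≤ c) :
    ∫ ω, (c ^ (-p) * (clusterSize (U · ω) (ε · ω) i n : ℝ)) ^ 2 ∂μ ≤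
      2 * (n / c) ^ (2 * p) * ((i : ℝ) + 1) ^ (-(2 * p)) := by
  simp only [mul_pow]
  rw [integral_const_mul]
  refine (mul_le_mul_of_nonneg_left (h.integral_clusterSize_sq_le hp i n)
    (by positivity)).trans (le_of_eq ?_)
  rw [Real.div_rpow (by positivity) (by positivity), Real.div_rpow (by positivity) hc,
    Real.rpow_neg hc, Real.rpow_neg (by positivity), inv_pow, ← Real.rpow_natCast,
    ← Real.rpow_mul hc, mul_comm p]
  push_cast
  ring

lemma ae_exists_tendsto_clusterSize (h : IsSharkNoise μ α p ξ U ε) (hp : 1 ≤ 2 * p) (hp1 : p ≤ 1)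
    (i : ℕ) : ∀ᵐ ω ∂μ, ∃ c, Tendsto
      (fun n : ℕ => (n : ℝ) ^ (-p) * (clusterSize (U · ω) (ε · ω) i n : ℝ)) atTop (𝓝 c) := by
  -- The bound is `3 = 1 + 2`: use `x ≤ 1 + x ^ 2` and a second moment of at most 2.
  have hb : ∀ k : ℕ, eLpNorm (fun ω => ((k + 1 : ℕ) : ℝ) ^ (-p) *
      (clusterSize (U · ω) (ε · ω) i (k + 1) : ℝ)) 1 μ ≤ ((3 : NNReal) : ENNReal) := by
    intro k
    have hk : (0 : ℝ) < ((k + 1 : ℕ) : ℝ) := by positivity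
    have h2 := h.integral_scaled_clusterSize_sq_le hp i (k + 1) hk.le
    rw [div_self hk.ne', Real.one_rpow, mul_one] at h2
    have h3 : ((i : ℝ) + 1) ^ (-(2 * p)) ≤ 1 :=
      Real.rpow_le_one_of_one_le_of_nonpos (by linarith [Nat.cast_nonneg (α := ℝ) i]) (by linarith)
    have hint := (h.integrable_clusterSize i (k + 1)).const_mul (((k + 1 : ℕ) : ℝ) ^ (-p))
    have hint2 : Integrable (fun ω => (((k + 1 : ℕ) : ℝ) ^ (-p) *
      (clusterSize (U · ω) (ε · ω) i (k + 1) : ℝ)) ^ 2) μ := by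
      simp only [mul_pow]
      exact (h.integrable_clusterSize_sq i (k + 1)).const_mul _
    rw [eLpNorm_one_eq_lintegral_enorm, ← ofReal_integral_norm_eq_lintegral_enorm hint]
    refine ENNReal.ofReal_le_of_le_toReal ?_
    calc _ ≤ ∫ ω, (1 + (((k + 1 : ℕ) : ℝ) ^ (-p) *
          (clusterSize (U · ω) (ε · ω) i (k + 1) : ℝ)) ^ 2) ∂μ := by
          refine integral_mono hint.norm ((integrable_const _).add hint2) fun ω => ?_
          rw [Real.norm_of_nonneg (by positivity)]
          simp only
          nlinarith [sq_nonneg ((((k + 1 : ℕ) : ℝ) ^ (-p) *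
            (clusterSize (U · ω) (ε · ω) i (k + 1) : ℝ)) - 1 / 2)]
      _ ≤ 3 := by
          rw [integral_add (integrable_const _) hint2]
          simp only [integral_const, probReal_univ, smul_eq_mul, mul_one]
          linarith
  filter_upwards [(h.submartingale_clusterSize hp1 i).exists_ae_tendsto_of_bdd hb] with ω ⟨c, hc⟩
  exact ⟨c, (tendsto_add_atTop_iff_nat 1).1 hc⟩

end IsSharkNoise

/-! ### Stable sums with deterministic weights -/

/-- Layer cake: the tail is at most 1 on `(0, 1]` and integrable on `(1, ∞)` since `α > 1`. -/
lemma lintegral_abs_le_of_tail_le {Ω : Type*} [MeasurableSpace Ω] {μ : Measure Ω}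
    [IsProbabilityMeasure μ] {Y : Ω → ℝ} (hY : Measurable Y) {α K : ℝ} (hα : 1 < α) (hK : 0 ≤ K)
    (h : ∀ r, 0 < r → μ.real {ω | r < |Y ω|} ≤ K * r ^ (-α)) :
    ∫⁻ ω, ENNReal.ofReal |Y ω| ∂μ ≤ ENNReal.ofReal (1 + K / (α - 1)) := by
  rw [lintegral_eq_lintegral_meas_lt μ (ae_of_all _ fun ω => abs_nonneg _) (by fun_prop),
    ← Set.Ioc_union_Ioi_eq_Ioi (zero_le_one (α := ℝ)),
    lintegral_union measurableSet_Ioi (Set.disjoint_left.2 fun x hx hx' => not_lt.2 hx.2 hx'),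
    ENNReal.ofReal_add zero_le_one (div_nonneg hK (by linarith))]
  refine add_le_add ?_ ?_
  · calc _ ≤ ∫⁻ _ in Set.Ioc (0 : ℝ) 1, 1 := lintegral_mono fun _ => prob_le_one
      _ = _ := by simp
  · have hint : IntegrableOn (fun t : ℝ => K * t ^ (-α)) (Set.Ioi 1) :=
      (integrableOn_Ioi_rpow_of_lt (by linarith) zero_lt_one).const_mul K
    calc _ ≤ ∫⁻ t in Set.Ioi (1 : ℝ), ENNReal.ofReal (K * t ^ (-α)) := by
          refine setLIntegral_mono_ae' measurableSet_Ioi (ae_of_all _ fun t ht => ?_)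
          have ht0 : (0 : ℝ) < t := zero_lt_one.trans ht
          rw [← ENNReal.ofReal_toReal (measure_ne_top μ _)]
          exact ENNReal.ofReal_le_ofReal (h t ht0)
      _ = ENNReal.ofReal (∫ t in Set.Ioi (1 : ℝ), K * t ^ (-α)) := by
          rw [ofReal_integral_eq_lintegral_ofReal hint]
          refine (ae_restrict_iff' measurableSet_Ioi).2 (ae_of_all _ fun t ht => ?_)
          have ht0 : (0 : ℝ) < t := zero_lt_one.trans ht
          exact mul_nonneg hK (by positivity)
      _ = _ := by
          rw [integral_const_mul, integral_Ioi_rpow_of_lt (by linarith) zero_lt_one,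
            Real.one_rpow]
          congr 1
          rw [show -α + 1 = -(α - 1) by ring, neg_div_neg_eq]
          ring

lemma EuclideanSpace.norm_le_sum_abs {d : ℕ} (x : EuclideanSpace ℝ (Fin d)) :
    ‖x‖ ≤ ∑ j, |x j| := by
  rw [EuclideanSpace.norm_eq]
  refine Real.sqrt_le_iff.2 ⟨Finset.sum_nonneg fun j _ => abs_nonneg _, ?_⟩
  simp only [Real.norm_eq_abs]
  exact Finset.sum_sq_le_sq_sum_of_nonneg fun j _ => abs_nonneg _

namespace IsSharkNoise

variable {Ω : Type*} [MeasurableSpace Ω] {μ : Measure Ω} {d : ℕ} {α p : ℝ}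
  {ξ : ℕ → Ω → EuclideanSpace ℝ (Fin d)} {U : ∀ k : ℕ, Ω → Fin (k + 1)} {ε : ℕ → Ω → Bool}

lemma charFun_sum_smul (h : IsSharkNoise μ α p ξ U ε) (s : Finset ℕ) (w : ℕ → ℝ)
    (θ : EuclideanSpace ℝ (Fin d)) :
    charFun (μ.map fun ω => ∑ i ∈ s, w i • ξ i ω) θ =
      ((Real.exp (-(‖θ‖ ^ α * ∑ i ∈ s, |w i| ^ α)) : ℝ) : ℂ) := by
  have hind : iIndepFun (fun i ω => w i • ξ i ω) μ :=
    h.indep_step.comp (fun i x => w i • x) fun i => measurable_const_smul (w i)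
  rw [iIndepFun.charFun_map_fun_finsetSum_eq_prod (X := fun i ω => w i • ξ i ω)
    (fun i _ => ((h.measurable_step i).const_smul (w i)).aemeasurable) (hind.restrict s),
    Finset.prod_apply, Finset.mul_sum, ← Finset.sum_neg_distrib, Real.exp_sum]
  push_cast
  refine Finset.prod_congr rfl fun i _ => ?_
  rw [charFun_map_smul_comp (h.measurable_step i).aemeasurable, h.charFun_step, norm_smul,
    Real.mul_rpow (norm_nonneg _) (norm_nonneg _), Real.norm_eq_abs, mul_comm]
  push_cast
  rfl

lemma measurable_sum_smul (h : IsSharkNoise μ α p ξ U ε) (s : Finset ℕ) (w : ℕ → ℝ) :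
    Measurable fun ω => ∑ i ∈ s, w i • ξ i ω :=
  Finset.measurable_sum _ fun i _ => (h.measurable_step i).const_smul (w i)

lemma measurable_coord (h : IsSharkNoise μ α p ξ U ε) (i : ℕ) (j : Fin d) :
    Measurable fun ω => ξ i ω j := by
  have := h.measurable_step i
  fun_prop

variable [IsProbabilityMeasure μ]

/-- The tail is bounded by the integral of `1 - charFun` over `|t| ≤ 2 / r`, where `1 - exp (-x) ≤
x`. This yields the constant `2 * 2 ^ α ≤ 8`. -/
lemma measureReal_coord_sum_smul_le (h : IsSharkNoise μ α p ξ U ε) (hα : 0 < α) (hα2 : α ≤ 2)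
    (s : Finset ℕ) (w : ℕ → ℝ) (j : Fin d) {r : ℝ} (hr : 0 < r) :
    μ.real {ω | r < |(∑ i ∈ s, w i • ξ i ω) j|} ≤ 8 * (∑ i ∈ s, |w i| ^ α) * r ^ (-α) := by
  set W := ∑ i ∈ s, |w i| ^ α with hW
  have hW0 : 0 ≤ W := Finset.sum_nonneg fun i _ => by positivity
  have hm := h.measurable_sum_smul s w
  have : IsProbabilityMeasure (μ.map fun ω => ∑ i ∈ s, w i • ξ i ω) :=
    Measure.isProbabilityMeasure_map hm.aemeasurable
  have key := measureReal_abs_inner_gt_le_integral_charFun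
    (μ := μ.map fun ω => ∑ i ∈ s, w i • ξ i ω) (a := EuclideanSpace.single j (1 : ℝ)) hr
  rw [map_measureReal_apply hm (measurableSet_lt measurable_const (by fun_prop))] at key
  simp only [EuclideanSpace.inner_single_left, Set.preimage_ofPred_eq, map_one, one_mul] at key
  refine key.trans ?_
  have hb : ‖∫ t in (-2 * r⁻¹)..(2 * r⁻¹),
      1 - charFun (μ.map fun ω => ∑ i ∈ s, w i • ξ i ω) (t • EuclideanSpace.single j (1 : ℝ))‖ ≤
      (2 * r⁻¹) ^ α * W * |2 * r⁻¹ - -2 * r⁻¹| := by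
    refine intervalIntegral.norm_integral_le_of_norm_le_const fun t ht => ?_
    have ht' : |t| ≤ 2 * r⁻¹ := by
      rw [Set.uIoc_of_le (by have := inv_pos.2 hr; linarith)] at ht
      exact abs_le.2 ⟨by linarith [ht.1], ht.2⟩
    rw [h.charFun_sum_smul, norm_smul, Real.norm_eq_abs, PiLp.norm_single,
      norm_one, mul_one, ← Complex.ofReal_one, ← Complex.ofReal_sub, Complex.norm_real,
      Real.norm_eq_abs]
    have h1 : |t| ^ α * W ≤ (2 * r⁻¹) ^ α * W :=
      mul_le_mul_of_nonneg_right (Real.rpow_le_rpow (abs_nonneg _) ht' hα.le) hW0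
    have h2 : 0 ≤ |t| ^ α * W := by positivity
    have h3 := Real.add_one_le_exp (-(|t| ^ α * W))
    have h4 : Real.exp (-(|t| ^ α * W)) ≤ 1 := Real.exp_le_one_iff.2 (by linarith)
    rw [abs_of_nonneg (by linarith)]
    linarith
  refine (mul_le_mul_of_nonneg_left hb (by positivity)).trans ?_
  have h5 : (2 : ℝ) ^ α ≤ 4 := by
    calc (2 : ℝ) ^ α ≤ 2 ^ (2 : ℝ) := Real.rpow_le_rpow_of_exponent_le one_le_two hα2
      _ = 4 := by norm_num
  have h6 : |2 * r⁻¹ - -2 * r⁻¹| = 4 * r⁻¹ := by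
    rw [abs_of_nonneg (by have := inv_pos.2 hr; linarith)]; ring
  rw [h6, Real.mul_rpow two_pos.le (inv_pos.2 hr).le, Real.inv_rpow hr.le, ← Real.rpow_neg hr.le]
  have h7 : 2⁻¹ * r * (2 ^ α * r ^ (-α) * W * (4 * r⁻¹)) = 2 * (2 ^ α) * (W * r ^ (-α)) := by
    field_simp
    ring
  rw [h7]
  have h8 : 0 ≤ W * r ^ (-α) := by positivity
  nlinarith

lemma exists_measure_norm_sum_smul_le (h : IsSharkNoise μ α p ξ U ε) (hα : 0 < α) (hα2 : α ≤ 2)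
    {δ : ℝ} (hδ : 0 < δ) : ∃ C : ℝ, 0 ≤ C ∧ ∀ (s : Finset ℕ) (w : ℕ → ℝ),
      μ {ω | δ ≤ ‖∑ i ∈ s, w i • ξ i ω‖} ≤ ENNReal.ofReal (C * ∑ i ∈ s, |w i| ^ α) := by
  -- A union bound over coordinates at level `δ / (d + 1)`: `d` coordinates within it have sum below
  -- `δ`, and `d = 0` is covered.
  refine ⟨d * (8 * (δ / (d + 1)) ^ (-α)), by positivity, fun s w => ?_⟩
  have hW0 : 0 ≤ ∑ i ∈ s, |w i| ^ α := Finset.sum_nonneg fun i _ => by positivity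
  have hsub : {ω | δ ≤ ‖∑ i ∈ s, w i • ξ i ω‖} ⊆
      ⋃ j : Fin d, {ω | δ / (d + 1) < |(∑ i ∈ s, w i • ξ i ω) j|} := by
    intro ω hω
    by_contra hc
    simp only [Set.mem_iUnion, Set.mem_ofPred_eq, not_exists, not_lt] at hc hω
    have h1 := hω.trans (EuclideanSpace.norm_le_sum_abs _)
    have h2 := h1.trans (Finset.sum_le_sum fun j _ => hc j)
    rw [Finset.sum_const, Finset.card_univ, Fintype.card_fin, nsmul_eq_mul, mul_div_assoc',
      le_div_iff₀ (by positivity)] at h2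
    linarith
  refine (measure_mono hsub).trans ((measure_iUnion_fintype_le _ _).trans ?_)
  calc _ ≤ ∑ _j : Fin d, ENNReal.ofReal (8 * (∑ i ∈ s, |w i| ^ α) * (δ / (d + 1)) ^ (-α)) := by
        refine Finset.sum_le_sum fun j _ => ?_
        rw [← ENNReal.ofReal_toReal (measure_ne_top μ _)]
        exact ENNReal.ofReal_le_ofReal
          (h.measureReal_coord_sum_smul_le hα hα2 s w j (by positivity))
    _ = _ := by
        rw [Finset.sum_const, Finset.card_univ, Fintype.card_fin, nsmul_eq_mul,
          ← ENNReal.ofReal_natCast, ← ENNReal.ofReal_mul (Nat.cast_nonneg _)]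
        congr 1
        ring

lemma lintegral_coord_sum_smul_le (h : IsSharkNoise μ α p ξ U ε) (hα : 1 < α) (hα2 : α ≤ 2)
    (s : Finset ℕ) (w : ℕ → ℝ) (j : Fin d) :
    ∫⁻ ω, ENNReal.ofReal |(∑ i ∈ s, w i • ξ i ω) j| ∂μ ≤
      ENNReal.ofReal (1 + 8 * (∑ i ∈ s, |w i| ^ α) / (α - 1)) :=
  lintegral_abs_le_of_tail_le (by have := h.measurable_sum_smul s w; fun_prop) hα
    (by have : 0 ≤ ∑ i ∈ s, |w i| ^ α := Finset.sum_nonneg fun i _ => by positivity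
        positivity)
    fun _ hr => h.measureReal_coord_sum_smul_le (by linarith) hα2 s w j hr

lemma integrable_coord (h : IsSharkNoise μ α p ξ U ε) (hα : 1 < α) (hα2 : α ≤ 2) (i : ℕ)
    (j : Fin d) : Integrable (fun ω => ξ i ω j) μ := by
  refine ⟨(h.measurable_coord i j).aestronglyMeasurable, ?_⟩
  have := h.lintegral_coord_sum_smul_le hα hα2 {i} (fun _ => 1) j
  simp only [Finset.sum_singleton, one_smul] at this
  rw [hasFiniteIntegral_iff_norm]
  exact this.trans_lt ENNReal.ofReal_lt_top

/-- The characteristic function depends on `‖θ‖` only, so the law is symmetric and the integral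
equals its own negative. -/
lemma integral_coord (h : IsSharkNoise μ α p ξ U ε) (i : ℕ) (j : Fin d) :
    ∫ ω, ξ i ω j ∂μ = 0 := by
  have hm := h.measurable_step i
  have hm' : Measurable fun ω => (-1 : ℝ) • ξ i ω := (measurable_const_smul (-1 : ℝ)).comp hm
  have hsymm : μ.map (fun ω => (-1 : ℝ) • ξ i ω) = μ.map (ξ i) := by
    have h1 : IsProbabilityMeasure (μ.map (ξ i)) :=
      Measure.isProbabilityMeasure_map hm.aemeasurable
    have h2 : IsProbabilityMeasure (μ.map fun ω => (-1 : ℝ) • ξ i ω) :=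
      Measure.isProbabilityMeasure_map hm'.aemeasurable
    refine Measure.ext_of_charFun (funext fun θ => ?_)
    rw [charFun_map_smul_comp hm.aemeasurable, h.charFun_step, h.charFun_step, norm_smul]
    simp
  have hf : Measurable fun x : EuclideanSpace ℝ (Fin d) => x j := by fun_prop
  have e1 : ∫ ω, ξ i ω j ∂μ = ∫ x, x j ∂(μ.map (ξ i)) :=
    (integral_map hm.aemeasurable hf.aestronglyMeasurable).symm
  have e2 : ∫ ω, -ξ i ω j ∂μ = ∫ x, x j ∂(μ.map (ξ i)) := by
    rw [← hsymm, integral_map hm'.aemeasurable hf.aestronglyMeasurable]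
    simp
  rw [integral_neg] at e2
  linarith

lemma martingale_coord_sum_smul (h : IsSharkNoise μ α p ξ U ε) (hα : 1 < α) (hα2 : α ≤ 2)
    (w : ℕ → ℝ) (j : Fin d) :
    Martingale (fun m ω => ∑ i ∈ Finset.range (m + 1), w i * ξ i ω j)
      (Filtration.natural (fun i ω => ξ i ω j) fun i => (h.measurable_coord i j).stronglyMeasurable)
      μ := by
  have hsm := fun i => (h.measurable_coord i j).stronglyMeasurable
  have hint := fun i => (h.integrable_coord hα hα2 i j).const_mul (w i)
  refine martingale_of_condExp_sub_eq_zero_nat (fun m => ?_)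
    (fun m => integrable_finsetSum _ fun i _ => hint i) fun m => ?_
  · refine Finset.stronglyMeasurable_fun_sum _ fun i hi => ?_
    refine StronglyMeasurable.const_mul ?_ (w i)
    exact (Filtration.stronglyAdapted_natural hsm i).mono
      ((Filtration.natural _ hsm).mono (Nat.lt_succ_iff.1 (Finset.mem_range.1 hi)))
  · have e : ((fun ω => ∑ i ∈ Finset.range (m + 1 + 1), w i * ξ i ω j) -
        fun ω => ∑ i ∈ Finset.range (m + 1), w i * ξ i ω j) =
        w (m + 1) • fun ω => ξ (m + 1) ω j := by
      ext ω
      simp [Finset.sum_range_succ _ (m + 1)]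
    have hind : iIndepFun (fun i ω => ξ i ω j) μ :=
      h.indep_step.comp (fun _ x => x j) fun _ => by fun_prop
    rw [e]
    refine (condExp_smul _ _ _).trans ?_
    filter_upwards [hind.condExp_natural_ae_eq_of_lt hsm (Nat.lt_succ_self m)] with ω hω
    rw [Pi.smul_apply, hω, h.integral_coord]
    simp

/-- Each coordinate is a martingale whose L¹ norms are bounded through the full sum `∑' i, |w i| ^
α`, so martingale convergence applies. -/
lemma ae_exists_tendsto_sum_smul (h : IsSharkNoise μ α p ξ U ε) (hα : 1 < α) (hα2 : α ≤ 2)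
    {w : ℕ → ℝ} (hw : Summable fun i => |w i| ^ α) :
    ∀ᵐ ω ∂μ, ∃ z, Tendsto (fun m => ∑ i ∈ Finset.range m, w i • ξ i ω) atTop (𝓝 z) := by
  have hj : ∀ j : Fin d, ∀ᵐ ω ∂μ, ∃ c,
      Tendsto (fun m => ∑ i ∈ Finset.range m, w i * ξ i ω j) atTop (𝓝 c) := by
    intro j
    have hb : ∀ m : ℕ, eLpNorm (fun ω => ∑ i ∈ Finset.range (m + 1), w i * ξ i ω j) 1 μ ≤
        ((1 + 8 * (∑' i, |w i| ^ α) / (α - 1)).toNNReal : ENNReal) := fun m => by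
      have h1 := h.lintegral_coord_sum_smul_le hα hα2 (Finset.range (m + 1)) w j
      rw [eLpNorm_one_eq_lintegral_enorm]
      simp only [← ofReal_norm, Real.norm_eq_abs]
      simp only [WithLp.ofLp_sum, WithLp.ofLp_smul, Finset.sum_apply, Pi.smul_apply,
        smul_eq_mul] at h1
      refine h1.trans (ENNReal.ofReal_le_ofReal ?_)
      have h2 := hw.sum_le_tsum (Finset.range (m + 1)) fun i _ => by positivity
      have h3 : 0 < α - 1 := by linarith
      gcongr
    filter_upwards [(h.martingale_coord_sum_smul hα hα2 w j).submartingale.exists_ae_tendsto_of_bdd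
      hb] with ω ⟨c, hc⟩
    exact ⟨c, (tendsto_add_atTop_iff_nat 1).1 hc⟩
  filter_upwards [ae_all_iff.2 hj] with ω hω
  choose c hc using hω
  refine ⟨WithLp.toLp 2 c, ?_⟩
  have h1 : Tendsto (fun m => WithLp.toLp 2 fun j => ∑ i ∈ Finset.range m, w i * ξ i ω j) atTop
      (𝓝 (WithLp.toLp 2 c)) :=
    ((PiLp.continuous_toLp 2 _).tendsto c).comp (tendsto_pi_nhds.2 hc)
  refine h1.congr fun m => ?_
  ext j
  simp

end IsSharkNoise

/-! ### Tools for passing to random weights and to the limit -/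

/-- A three-`δ` argument; it works because the error bound `c m` does not depend on `n`. -/
lemma tendstoInMeasure_of_approx {Ω E : Type*} [MeasurableSpace Ω] {μ : Measure Ω}
    [NormedAddCommGroup E] {f : ℕ → Ω → E} {a : ℕ → ℕ → Ω → E} {b : ℕ → Ω → E} {g : Ω → E}
    (hab : ∀ m, TendstoInMeasure μ (a m) atTop (b m)) (hb : TendstoInMeasure μ b atTop g)
    (hf : ∀ δ : ℝ, 0 < δ → ∃ c : ℕ → ENNReal, Tendsto c atTop (𝓝 0) ∧
      ∀ m n, μ {ω | δ ≤ ‖f n ω - a m n ω‖} ≤ c m) :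
    TendstoInMeasure μ f atTop g := by
  rw [tendstoInMeasure_iff_norm] at hb ⊢
  intro δ hδ
  have hδ3 : 0 < δ / 3 := by positivity
  obtain ⟨c, hc, hfc⟩ := hf (δ / 3) hδ3
  rw [ENNReal.tendsto_nhds_zero]
  intro η hη
  have hη3 : 0 < η / 3 := ENNReal.div_pos hη.ne' (by norm_num)
  obtain ⟨m, hm1, hm2⟩ := ((ENNReal.tendsto_nhds_zero.1 hc _ hη3).and
    (ENNReal.tendsto_nhds_zero.1 (hb _ hδ3) _ hη3)).exists
  filter_upwards [ENNReal.tendsto_nhds_zero.1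
    (tendstoInMeasure_iff_norm.1 (hab m) _ hδ3) _ hη3] with n hn
  have hsub : {ω | δ ≤ ‖f n ω - g ω‖} ⊆ ({ω | δ / 3 ≤ ‖f n ω - a m n ω‖} ∪
      {ω | δ / 3 ≤ ‖a m n ω - b m ω‖}) ∪ {ω | δ / 3 ≤ ‖b m ω - g ω‖} := by
    intro ω hω
    by_contra hcon
    simp only [Set.mem_union, Set.mem_ofPred_eq, not_or, not_le] at hcon hω
    have h1 : f n ω - g ω = (f n ω - a m n ω) + (a m n ω - b m ω) + (b m ω - g ω) := by abel
    rw [h1] at hω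
    have h2 := norm_add₃_le (a := f n ω - a m n ω) (b := a m n ω - b m ω) (c := b m ω - g ω)
    linarith [hcon.1.1, hcon.1.2, hcon.2]
  calc _ ≤ _ := measure_mono hsub
    _ ≤ _ := measure_union_le _ _
    _ ≤ (η / 3 + η / 3) + η / 3 := by
        refine add_le_add ((measure_union_le _ _).trans (add_le_add ((hfc m n).trans hm1) hn)) hm2
    _ = η := ENNReal.add_thirds η

/-- Fubini on the product law; it allows `g`, later the tree, to be frozen while `f`, later the
steps, stays random. -/
lemma measure_setOf_prodMk_mem_of_indepFun {Ω A B : Type*} [MeasurableSpace Ω] {μ : Measure Ω}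
    [IsProbabilityMeasure μ] [MeasurableSpace A] [MeasurableSpace B] {f : Ω → A} {g : Ω → B}
    (hf : Measurable f) (hg : Measurable g) (hfg : IndepFun f g μ) {S : Set (A × B)}
    (hS : MeasurableSet S) :
    μ {ω | (f ω, g ω) ∈ S} = ∫⁻ ω', μ {ω | (f ω, g ω') ∈ S} ∂μ := by
  have h1 : μ {ω | (f ω, g ω) ∈ S} = μ.map (fun ω => (f ω, g ω)) S :=
    (Measure.map_apply (hf.prodMk hg) hS).symm
  have : IsProbabilityMeasure (μ.map f) := Measure.isProbabilityMeasure_map hf.aemeasurable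
  have : IsProbabilityMeasure (μ.map g) := Measure.isProbabilityMeasure_map hg.aemeasurable
  rw [h1, hfg.map_prod_eq_prod_map_map hf.aemeasurable hg.aemeasurable,
    Measure.prod_apply_symm hS, lintegral_map (measurable_measure_prodMk_right hS) hg]
  refine lintegral_congr fun ω' => ?_
  rw [Measure.map_apply hf (measurable_prodMk_right hS)]
  rfl

/-- Replaces Jensen's inequality: with `s` the typical size of `y`, a second moment of order `s ^ 2`
gives an `α`-th moment of order `s ^ α`. -/
lemma Real.rpow_le_rpow_mul_one_add_sq {y s α : ℝ} (hy : 0 ≤ y) (hs : 0 < s) (hα : 0 ≤ α)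
    (hα2 : α ≤ 2) : y ^ α ≤ s ^ α * (1 + (y / s) ^ 2) := by
  have h1 : y ^ α = s ^ α * (y / s) ^ α := by
    rw [← Real.mul_rpow hs.le (by positivity), mul_div_cancel₀ _ hs.ne']
  rw [h1]
  refine mul_le_mul_of_nonneg_left ?_ (by positivity)
  have h0 : 0 ≤ y / s := by positivity
  rcases le_total (y / s) 1 with h | h
  · have := Real.rpow_le_one h0 h hα
    have := sq_nonneg (y / s)
    linarith
  · have h2 := Real.rpow_le_rpow_of_exponent_le h hα2
    rw [Real.rpow_two] at h2
    linarith

/-- The limit of the rescaled sizes of the cluster rooted at `i`, when it exists. -/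
noncomputable def clusterLimit (p : ℝ) (i : ℕ) (t : (∀ k : ℕ, Fin (k + 1)) × (ℕ → Bool)) : ℝ :=
  limsup (fun n : ℕ => (n : ℝ) ^ (-p) * (clusterSize t.1 t.2 i n : ℝ)) atTop

lemma measurable_clusterSize_prod (i n : ℕ) :
    Measurable fun t : (∀ k : ℕ, Fin (k + 1)) × (ℕ → Bool) => (clusterSize t.1 t.2 i n : ℝ) := by
  cases n with
  | zero => simp [clusterSize]
  | succ n =>
    have hU : ∀ k < n, Measurable fun t : (∀ k : ℕ, Fin (k + 1)) × (ℕ → Bool) => t.1 k :=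
      fun k _ => (measurable_pi_apply k).comp measurable_fst
    have hε : ∀ k < n, Measurable fun t : (∀ k : ℕ, Fin (k + 1)) × (ℕ → Bool) => t.2 k :=
      fun k _ => (measurable_pi_apply k).comp measurable_snd
    exact measurable_clusterSize hU hε i

lemma measurable_clusterLimit (p : ℝ) (i : ℕ) : Measurable (clusterLimit p i) :=
  Measurable.limsup fun n => (measurable_clusterSize_prod i n).const_mul _

lemma sum_range_eq_add_sum_Ico {E : Type*} [AddCommMonoid E] {f : ℕ → E} {n : ℕ}
    (hf : ∀ i, n ≤ i → f i = 0) (m : ℕ) :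
    ∑ i ∈ Finset.range n, f i = ∑ i ∈ Finset.range m, f i + ∑ i ∈ Finset.Ico m n, f i := by
  rcases le_total m n with h | h
  · exact (Finset.sum_range_add_sum_Ico f h).symm
  · rw [Finset.Ico_eq_empty_of_le h, Finset.sum_empty, add_zero]
    exact Finset.sum_subset (Finset.range_mono h) fun i _ hi => hf i (by simpa using hi)

lemma summable_add_one_rpow_neg {α p : ℝ} (hαp : 1 < α * p) :
    Summable fun i : ℕ => ((i : ℝ) + 1) ^ (-(α * p)) := by
  have := (summable_nat_add_iff 1).2 (Real.summable_nat_rpow.2 (by linarith : -(α * p) < -1))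
  simpa using this

lemma tsum_ofReal_add_one_rpow_neg_ne_top {α p : ℝ} (hαp : 1 < α * p) {D : ℝ} (hD : 0 ≤ D) :
    ∑' i : ℕ, ENNReal.ofReal (D * ((i : ℝ) + 1) ^ (-(α * p))) ≠ ⊤ := by
  rw [← ENNReal.ofReal_tsum_of_nonneg (fun i => by positivity)
    ((summable_add_one_rpow_neg hαp).mul_left D)]
  exact ENNReal.ofReal_ne_top

lemma tendsto_clusterSize_floor {p : ℝ} (hp : 0 < p) {N : ℕ → ℕ} (hN : N 0 = 0) {x : ℝ}
    (hx : Tendsto (fun n : ℕ => (n : ℝ) ^ (-p) * (N n : ℝ)) atTop (𝓝 x)) {t : ℝ} (ht : 0 ≤ t) :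
    Tendsto (fun n : ℕ => (n : ℝ) ^ (-p) * (N ⌊(n : ℝ) * t⌋₊ : ℝ)) atTop (𝓝 (t ^ p * x)) := by
  rcases ht.eq_or_lt with rfl | ht
  -- At `t = 0` the floor does not tend to infinity; both sides vanish because `N 0 = 0` and `p ≠
  -- 0`.
  · simp [hN, Real.zero_rpow hp.ne']
  have h1 : Tendsto (fun n : ℕ => ⌊(n : ℝ) * t⌋₊) atTop atTop :=
    tendsto_nat_floor_atTop.comp (tendsto_natCast_atTop_atTop.atTop_mul_const ht)
  have h2 : Tendsto (fun n : ℕ => ((⌊(n : ℝ) * t⌋₊ : ℝ) / n) ^ p) atTop (𝓝 (t ^ p)) := by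
    refine Tendsto.rpow_const ?_ (Or.inr hp.le)
    simpa only [mul_comm, Function.comp_def] using
      (tendsto_nat_floor_mul_div_atTop ht.le).comp (tendsto_natCast_atTop_atTop (R := ℝ))
  refine (h2.mul (hx.comp h1)).congr' ?_
  filter_upwards [h1.eventually_ge_atTop 1] with n hn
  have h3 : (0 : ℝ) < (⌊(n : ℝ) * t⌋₊ : ℝ) := by exact_mod_cast hn
  simp only [Function.comp_apply]
  rw [Real.div_rpow h3.le (Nat.cast_nonneg n), Real.rpow_neg h3.le,
    Real.rpow_neg (Nat.cast_nonneg n)]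
  field_simp

/-! ### Random weights: the limits, the series and the tail -/

namespace IsSharkNoise

variable {Ω : Type*} [MeasurableSpace Ω] {μ : Measure Ω} {d : ℕ} {α p : ℝ}
  {ξ : ℕ → Ω → EuclideanSpace ℝ (Fin d)} {U : ∀ k : ℕ, Ω → Fin (k + 1)} {ε : ℕ → Ω → Bool}

lemma measurable_steps (h : IsSharkNoise μ α p ξ U ε) : Measurable fun ω k => ξ k ω :=
  measurable_pi_lambda _ h.measurable_step

lemma measurable_tree (h : IsSharkNoise μ α p ξ U ε) :
    Measurable fun ω => ((fun k => U k ω), (fun k => ε k ω)) :=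
  (measurable_pi_lambda _ h.measurable_choice).prodMk (measurable_pi_lambda _ h.measurable_keep)

variable [IsProbabilityMeasure μ]

/-- Taking a `limsup` as the limit makes it an everywhere defined measurable function of the tree
alone, as needed for freezing the tree. -/
lemma ae_tendsto_clusterLimit (h : IsSharkNoise μ α p ξ U ε) (hp : 1 ≤ 2 * p) (hp1 : p ≤ 1)
    (i : ℕ) : ∀ᵐ ω ∂μ, Tendsto
      (fun n : ℕ => (n : ℝ) ^ (-p) * (clusterSize (U · ω) (ε · ω) i n : ℝ)) atTop
      (𝓝 (clusterLimit p i ((U · ω), (ε · ω)))) := by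
  filter_upwards [h.ae_exists_tendsto_clusterSize hp hp1 i] with ω ⟨c, hc⟩
  have : clusterLimit p i ((U · ω), (ε · ω)) = c := hc.limsup_eq
  rwa [this]

lemma lintegral_scaled_clusterSize_rpow_le (h : IsSharkNoise μ α p ξ U ε) (hα : 0 ≤ α)
    (hα2 : α ≤ 2) (hp : 1 ≤ 2 * p) (i n : ℕ) {c : ℝ} (hc : 0 ≤ c) :
    ∫⁻ ω, ENNReal.ofReal ((c ^ (-p) * (clusterSize (U · ω) (ε · ω) i n : ℝ)) ^ α) ∂μ ≤
      ENNReal.ofReal ((1 + 2 * (n / c) ^ (2 * p)) * ((i : ℝ) + 1) ^ (-(α * p))) := by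
  have hi : (0 : ℝ) < i + 1 := by positivity
  -- The typical size of the rescaled cluster, read off from the second moment bound.
  set s : ℝ := ((i : ℝ) + 1) ^ (-p) with hs
  have hs0 : 0 < s := by positivity
  have hsα : s ^ α = ((i : ℝ) + 1) ^ (-(α * p)) := by
    rw [hs, ← Real.rpow_mul hi.le]; ring_nf
  have hs2 : s ^ 2 = ((i : ℝ) + 1) ^ (-(2 * p)) := by
    rw [hs, ← Real.rpow_natCast, ← Real.rpow_mul hi.le]; push_cast; ring_nf
  have hint : Integrable (fun ω =>
      (c ^ (-p) * (clusterSize (U · ω) (ε · ω) i n : ℝ)) ^ 2) μ := by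
    simp only [mul_pow]
    exact (h.integrable_clusterSize_sq i n).const_mul _
  have hint2 : Integrable (fun ω =>
      s ^ α * (1 + ((c ^ (-p) * (clusterSize (U · ω) (ε · ω) i n : ℝ)) / s) ^ 2)) μ := by
    simp only [div_pow]
    exact ((integrable_const 1).add (hint.div_const _)).const_mul _
  calc _ ≤ ∫⁻ ω, ENNReal.ofReal
        (s ^ α * (1 + ((c ^ (-p) * (clusterSize (U · ω) (ε · ω) i n : ℝ)) / s) ^ 2)) ∂μ :=
        lintegral_mono fun ω => ENNReal.ofReal_le_ofReal
          (Real.rpow_le_rpow_mul_one_add_sq (by positivity) hs0 hα hα2)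
    _ = ENNReal.ofReal (∫ ω,
        (s ^ α * (1 + ((c ^ (-p) * (clusterSize (U · ω) (ε · ω) i n : ℝ)) / s) ^ 2)) ∂μ) :=
        (ofReal_integral_eq_lintegral_ofReal hint2 (ae_of_all _ fun ω => by positivity)).symm
    _ ≤ _ := by
        refine ENNReal.ofReal_le_ofReal ?_
        simp only [div_pow]
        rw [integral_const_mul, integral_add (integrable_const _) (hint.div_const _),
          integral_div, ← hsα, mul_comm]
        refine mul_le_mul_of_nonneg_right ?_ (by positivity)
        have h2 := h.integral_scaled_clusterSize_sq_le hp i n hc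
        rw [← hs2] at h2
        have h3 := (div_le_iff₀ (by positivity : 0 < s ^ 2)).2 h2
        simp only [integral_const, probReal_univ, smul_eq_mul, mul_one]
        linarith

/-- Fatou's lemma; with scale equal to size the moment constant is `1 + 2 = 3` for every `n ≥ 1`. -/
lemma lintegral_clusterLimit_rpow_le (h : IsSharkNoise μ α p ξ U ε) (hα : 0 ≤ α)
    (hα2 : α ≤ 2) (hp : 1 ≤ 2 * p) (hp1 : p ≤ 1) (i : ℕ) :
    ∫⁻ ω, ENNReal.ofReal (|clusterLimit p i ((U · ω), (ε · ω))| ^ α) ∂μ ≤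
      ENNReal.ofReal (3 * ((i : ℝ) + 1) ^ (-(α * p))) := by
  calc _ ≤ ∫⁻ ω, liminf (fun n : ℕ => ENNReal.ofReal
        (((n : ℝ) ^ (-p) * (clusterSize (U · ω) (ε · ω) i n : ℝ)) ^ α)) atTop ∂μ := by
        refine lintegral_mono_ae ?_
        filter_upwards [h.ae_tendsto_clusterLimit hp hp1 i] with ω hω
        have h1 := ENNReal.tendsto_ofReal (hω.abs.rpow_const (Or.inr hα))
        refine h1.liminf_eq.symm.le.trans (le_of_eq ?_)
        congr 1
        ext n
        rw [abs_of_nonneg (by positivity)]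
    _ ≤ liminf (fun n : ℕ => ∫⁻ ω, ENNReal.ofReal
        (((n : ℝ) ^ (-p) * (clusterSize (U · ω) (ε · ω) i n : ℝ)) ^ α) ∂μ) atTop := by
        refine lintegral_liminf_le' fun n => ?_
        have := h.measurable_clusterSize i n
        exact (((this.const_mul _).pow_const α).ennreal_ofReal).aemeasurable
    _ ≤ _ := by
        refine liminf_le_of_le (by isBoundedDefault) fun b hb => ?_
        obtain ⟨n, hn, hn1⟩ := (hb.and (eventually_ge_atTop 1)).exists
        refine hn.trans ((h.lintegral_scaled_clusterSize_rpow_le hα hα2 hp i n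
          (Nat.cast_nonneg n)).trans (le_of_eq ?_))
        rw [div_self (by positivity), Real.one_rpow]
        norm_num

lemma ae_summable_clusterLimit (h : IsSharkNoise μ α p ξ U ε) (hα : 0 ≤ α)
    (hα2 : α ≤ 2) (hp : 1 ≤ 2 * p) (hp1 : p ≤ 1) (hαp : 1 < α * p) :
    ∀ᵐ ω ∂μ, Summable fun i => |clusterLimit p i ((U · ω), (ε · ω))| ^ α := by
  have hm : ∀ i, Measurable fun ω =>
      ENNReal.ofReal (|clusterLimit p i ((U · ω), (ε · ω))| ^ α) := fun i => by
    have := (measurable_clusterLimit p i).comp h.measurable_tree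
    exact (this.abs.pow_const α).ennreal_ofReal
  have hfin : ∫⁻ ω, ∑' i, ENNReal.ofReal (|clusterLimit p i ((U · ω), (ε · ω))| ^ α) ∂μ ≠ ⊤ := by
    rw [lintegral_tsum fun i => (hm i).aemeasurable]
    exact ne_top_of_le_ne_top (tsum_ofReal_add_one_rpow_neg_ne_top hαp (by norm_num : (0 : ℝ) ≤ 3))
      (ENNReal.tsum_le_tsum fun i => h.lintegral_clusterLimit_rpow_le hα hα2 hp hp1 i)
  filter_upwards [ae_lt_top (Measurable.tsum hm) hfin] with ω hω
  have := ENNReal.summable_toReal hω.ne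
  refine this.congr fun i => ?_
  rw [ENNReal.toReal_ofReal (by positivity)]

lemma ae_exists_tendsto_sum_clusterLimit_smul (h : IsSharkNoise μ α p ξ U ε) (hα : 1 < α)
    (hα2 : α ≤ 2) (hp : 1 ≤ 2 * p) (hp1 : p ≤ 1) (hαp : 1 < α * p) :
    ∀ᵐ ω ∂μ, ∃ z, Tendsto (fun m => ∑ i ∈ Finset.range m,
      clusterLimit p i ((U · ω), (ε · ω)) • ξ i ω) atTop (𝓝 z) := by
  let S : Set ((ℕ → EuclideanSpace ℝ (Fin d)) × ((∀ k : ℕ, Fin (k + 1)) × (ℕ → Bool))) :=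
    {q | ∃ z, Tendsto (fun m => ∑ i ∈ Finset.range m, clusterLimit p i q.2 • q.1 i) atTop (𝓝 z)}
  have hm : ∀ m, Measurable fun
      q : (ℕ → EuclideanSpace ℝ (Fin d)) × ((∀ k : ℕ, Fin (k + 1)) × (ℕ → Bool)) =>
      ∑ i ∈ Finset.range m, clusterLimit p i q.2 • q.1 i := fun m =>
    Finset.measurable_sum _ fun i _ => ((measurable_clusterLimit p i).comp measurable_snd).smul
      ((measurable_pi_apply i).comp measurable_fst)
  have hS : MeasurableSet S := measurableSet_exists_tendsto hm
  have key := measure_setOf_prodMk_mem_of_indepFun h.measurable_steps h.measurable_tree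
    h.indep_step_tree hS.compl
  have h2 : ∫⁻ ω', μ {ω | ((fun k => ξ k ω), ((fun k => U k ω'), (fun k => ε k ω'))) ∈ Sᶜ} ∂μ
      = 0 := by
    refine lintegral_eq_zero_of_ae_eq_zero ?_
    filter_upwards [h.ae_summable_clusterLimit (by linarith) hα2 hp hp1 hαp] with ω' hω'
    have h3 := h.ae_exists_tendsto_sum_smul hα hα2 hω'
    exact ae_iff.1 h3
  have h4 := measure_eq_zero_iff_ae_notMem.1 (key.trans h2)
  filter_upwards [h4] with ω hω
  exact not_not.1 hω

/-- The bound for frozen weights is linear in `∑ |w i| ^ α`, so integrating over the tree only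
requires the `α`-th moments of the sizes. -/
lemma measure_norm_tail_le (h : IsSharkNoise μ α p ξ U ε) (hα : 0 < α) (hα2 : α ≤ 2)
    (hp : 1 ≤ 2 * p) {δ : ℝ} (hδ : 0 < δ) : ∃ C : ℝ, 0 ≤ C ∧ ∀ (s : Finset ℕ) (c : ℝ) (n : ℕ),
      0 ≤ c → μ {ω | δ ≤ ‖∑ i ∈ s,
        (c ^ (-p) * (clusterSize (U · ω) (ε · ω) i n : ℝ)) • ξ i ω‖} ≤ ∑ i ∈ s,
          ENNReal.ofReal (C * (1 + 2 * (n / c) ^ (2 * p)) * ((i : ℝ) + 1) ^ (-(α * p))) := by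
  obtain ⟨C, hC0, hC⟩ := h.exists_measure_norm_sum_smul_le hα hα2 hδ
  refine ⟨C, hC0, fun s c n hc => ?_⟩
  let S : Set ((ℕ → EuclideanSpace ℝ (Fin d)) × ((∀ k : ℕ, Fin (k + 1)) × (ℕ → Bool))) :=
    {q | δ ≤ ‖∑ i ∈ s, (c ^ (-p) * (clusterSize q.2.1 q.2.2 i n : ℝ)) • q.1 i‖}
  have hS : MeasurableSet S := by
    refine measurableSet_le measurable_const (Measurable.norm ?_)
    refine Finset.measurable_sum _ fun i _ => ?_
    exact (((measurable_clusterSize_prod i n).comp measurable_snd).const_mul _).smul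
      ((measurable_pi_apply i).comp measurable_fst)
  refine (measure_setOf_prodMk_mem_of_indepFun h.measurable_steps h.measurable_tree
    h.indep_step_tree hS).trans_le ?_
  calc _ ≤ ∫⁻ ω', ENNReal.ofReal (C * ∑ i ∈ s,
        |c ^ (-p) * (clusterSize (U · ω') (ε · ω') i n : ℝ)| ^ α) ∂μ :=
        lintegral_mono fun ω' => hC s _
    _ = ∫⁻ ω', ∑ i ∈ s, ENNReal.ofReal C * ENNReal.ofReal
        ((c ^ (-p) * (clusterSize (U · ω') (ε · ω') i n : ℝ)) ^ α) ∂μ := by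
        refine lintegral_congr fun ω' => ?_
        rw [Finset.mul_sum, ENNReal.ofReal_sum_of_nonneg fun i _ => by positivity]
        refine Finset.sum_congr rfl fun i _ => ?_
        rw [abs_of_nonneg (by positivity), ENNReal.ofReal_mul hC0]
    _ = ∑ i ∈ s, ENNReal.ofReal C * ∫⁻ ω', ENNReal.ofReal
        ((c ^ (-p) * (clusterSize (U · ω') (ε · ω') i n : ℝ)) ^ α) ∂μ := by
        have hm : ∀ i, Measurable fun ω' => ENNReal.ofReal
            ((c ^ (-p) * (clusterSize (U · ω') (ε · ω') i n : ℝ)) ^ α) := fun i =>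
          (((h.measurable_clusterSize i n).const_mul _).pow_const α).ennreal_ofReal
        rw [lintegral_finsetSum _ fun i _ => (hm i).const_mul _]
        exact Finset.sum_congr rfl fun i _ => lintegral_const_mul _ (hm i)
    _ ≤ _ := by
        refine Finset.sum_le_sum fun i _ => ?_
        rw [mul_assoc, ENNReal.ofReal_mul hC0]
        gcongr
        exact h.lintegral_scaled_clusterSize_rpow_le hα.le hα2 hp i n hc

end IsSharkNoise

/-! ### Convergence in probability of the swim -/

namespace IsSharkNoise

variable {Ω : Type*} [MeasurableSpace Ω] {μ : Measure Ω} {d : ℕ} {α p : ℝ}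
  {ξ : ℕ → Ω → EuclideanSpace ℝ (Fin d)} {U : ∀ k : ℕ, Ω → Fin (k + 1)} {ε : ℕ → Ω → Bool}
  [IsProbabilityMeasure μ]

lemma tendstoInMeasure_sharkSwim (h : IsSharkNoise μ α p ξ U ε) (hα : 0 < α) (hα2 : α ≤ 2)
    (hp : 1 ≤ 2 * p) (hp1 : p ≤ 1) (hαp : 1 < α * p) {Z : Ω → EuclideanSpace ℝ (Fin d)}
    (hZ : ∀ᵐ ω ∂μ, Tendsto (fun m => ∑ i ∈ Finset.range m,
      clusterLimit p i ((U · ω), (ε · ω)) • ξ i ω) atTop (𝓝 (Z ω))) {t : ℝ} (ht : 0 ≤ t) :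
    TendstoInMeasure μ (fun (n : ℕ) ω =>
      (n : ℝ) ^ (-p) • sharkSwim (ξ · ω) (U · ω) (ε · ω) ⌊(n : ℝ) * t⌋₊)
      atTop (fun ω => t ^ p • Z ω) := by
  have hXm : ∀ i, Measurable fun ω => clusterLimit p i ((U · ω), (ε · ω)) := fun i =>
    (measurable_clusterLimit p i).comp h.measurable_tree
  refine tendstoInMeasure_of_approx
    (a := fun m n ω => ∑ i ∈ Finset.range m,
      ((n : ℝ) ^ (-p) * (clusterSize (U · ω) (ε · ω) i ⌊(n : ℝ) * t⌋₊ : ℝ)) • ξ i ω)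
    (b := fun m ω => t ^ p • ∑ i ∈ Finset.range m,
      clusterLimit p i ((U · ω), (ε · ω)) • ξ i ω) (fun m => ?_) ?_ fun δ hδ => ?_
  · refine tendstoInMeasure_of_tendsto_ae (fun n => ?_) ?_
    · refine (Finset.measurable_sum _ fun i _ => ?_).aestronglyMeasurable
      exact ((h.measurable_clusterSize i _).const_mul _).smul (h.measurable_step i)
    · filter_upwards [ae_all_iff.2 fun i => h.ae_tendsto_clusterLimit hp hp1 i] with ω hω
      rw [Finset.smul_sum]
      refine tendsto_finsetSum _ fun i _ => ?_
      rw [smul_smul]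
      exact (tendsto_clusterSize_floor (by linarith) (by simp [clusterSize]) (hω i)
        ht).smul_const (ξ i ω)
  · refine tendstoInMeasure_of_tendsto_ae (fun m => ?_) ?_
    · have hm : Measurable fun ω => ∑ i ∈ Finset.range m,
          clusterLimit p i ((U · ω), (ε · ω)) • ξ i ω :=
        Finset.measurable_sum _ fun i _ => (hXm i).smul (h.measurable_step i)
      exact hm.aestronglyMeasurable.const_smul (t ^ p)
    · filter_upwards [hZ] with ω hω
      exact hω.const_smul _
  · obtain ⟨C, hC0, hC⟩ := h.measure_norm_tail_le hα hα2 hp hδ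
    have hD : 0 ≤ C * (1 + 2 * t ^ (2 * p)) := by positivity
    refine ⟨_, ENNReal.tendsto_sum_nat_add _ (tsum_ofReal_add_one_rpow_neg_ne_top hαp hD),
      fun m n => ?_⟩
    have e : ∀ ω, (n : ℝ) ^ (-p) • sharkSwim (ξ · ω) (U · ω) (ε · ω) ⌊(n : ℝ) * t⌋₊ -
        ∑ i ∈ Finset.range m,
          ((n : ℝ) ^ (-p) * (clusterSize (U · ω) (ε · ω) i ⌊(n : ℝ) * t⌋₊ : ℝ)) • ξ i ω =
        ∑ i ∈ Finset.Ico m ⌊(n : ℝ) * t⌋₊,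
          ((n : ℝ) ^ (-p) * (clusterSize (U · ω) (ε · ω) i ⌊(n : ℝ) * t⌋₊ : ℝ)) • ξ i ω := by
      intro ω
      rw [sharkSwim_eq_sum_clusterSize, Finset.smul_sum, sub_eq_iff_eq_add']
      simp only [smul_smul]
      refine sum_range_eq_add_sum_Ico (fun i hi => ?_) m
      rw [clusterSize_eq_zero _ _ hi]
      simp
    simp only [e]
    refine (hC _ _ _ (Nat.cast_nonneg n)).trans ?_
    rw [Finset.sum_Ico_eq_sum_range]
    refine le_trans (Finset.sum_le_sum fun i _ => ?_) (ENNReal.sum_le_tsum _)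
    rw [add_comm m i]
    refine ENNReal.ofReal_le_ofReal ?_
    -- This includes `n = 0`, where the quotient is 0 by convention.
    have hnt : (⌊(n : ℝ) * t⌋₊ : ℝ) / n ≤ t :=
      div_le_of_le_mul₀ (Nat.cast_nonneg n) ht
        ((Nat.floor_le (by positivity)).trans_eq (mul_comm _ _))
    gcongr

end IsSharkNoise

theorem theorem1 {Ω : Type*} [MeasurableSpace Ω] (μ : Measure Ω) [IsProbabilityMeasure μ]
    (d : ℕ) (α p : ℝ) (hα0 : 0 < α) (hα2 : α ≤ 2) (hp0 : 0 < p) (hp1 : p < 1) (hαp : 1 < α * p)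
    (ξ : ℕ → Ω → EuclideanSpace ℝ (Fin d)) (U : ∀ k : ℕ, Ω → Fin (k + 1)) (ε : ℕ → Ω → Bool)
    (hnoise : IsSharkNoise μ α p ξ U ε) :
    ∃ (X : ℕ → Ω → ℝ) (Z : Ω → EuclideanSpace ℝ (Fin d)),
      (∀ i, Measurable (X i)) ∧ Measurable Z ∧
      (∀ i, ∀ᵐ ω ∂μ, Tendsto
        (fun n : ℕ => (n : ℝ) ^ (-p) * ((cluster (U · ω) (ε · ω) i n).ncard : ℝ))
        atTop (𝓝 (X i ω))) ∧
      (∀ᵐ ω ∂μ, Tendsto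
        (fun m : ℕ => ∑ i ∈ Finset.range m, X i ω • ξ i ω) atTop (𝓝 (Z ω))) ∧
      ∀ t : ℝ, 0 ≤ t → TendstoInMeasure μ
        (fun (n : ℕ) ω =>
          (n : ℝ) ^ (-p) • sharkSwim (ξ · ω) (U · ω) (ε · ω) ⌊(n : ℝ) * t⌋₊)
        atTop (fun ω => t ^ p • Z ω) := by
  -- From `1 < α * p`: `α ≤ 2` gives `1 < 2 * p`, and `p < 1` gives `1 < α`.
  have hp : 1 ≤ 2 * p := by nlinarith
  have hα1 : 1 < α := by nlinarith
  obtain ⟨Z, hZm, hZ⟩ := measurable_limit_of_tendsto_metrizable_ae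
    (f := fun m ω => ∑ i ∈ Finset.range m, clusterLimit p i ((U · ω), (ε · ω)) • ξ i ω)
    (fun m => (Finset.measurable_sum _ fun i _ => (((measurable_clusterLimit p i).comp
      hnoise.measurable_tree).smul (hnoise.measurable_step i))).aemeasurable)
    (hnoise.ae_exists_tendsto_sum_clusterLimit_smul hα1 hα2 hp hp1.le hαp)
  refine ⟨fun i ω => clusterLimit p i ((U · ω), (ε · ω)), Z, fun i =>
    (measurable_clusterLimit p i).comp hnoise.measurable_tree, hZm, fun i => ?_, hZ, fun t ht =>
    hnoise.tendstoInMeasure_sharkSwim hα0 hα2 hp hp1.le hαp hZ ht⟩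
  simp only [ncard_cluster]
  exact hnoise.ae_tendsto_clusterLimit hp hp1.le i
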